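/- A geometric graph is a finite simple graph $G=(V,E)$ whose vertices are distinct points of the plane and whose edges are drawn as straight line segments. Two distinct edges cross if the relative interiors of their segments intersect, and $\mathrm{cr}(G)$ is the number of unordered pairs of edges of $G$ that cross. The model of computation is the real RAM: integer memory cells hold machine words of $O(\log n)$ bits, real memory cells hold real numbers, and each arithmetic operation, comparison and (indirectly addressed) memory access costs one step. The input consists of the number $n=|V|$, the adjacency matrix of $G$ and the coordinates of the vertices; time bounds of the form $O(n^2)$ mean at most $C(n^2+1)$ steps for an absolute constant $C$. (a) A convex geometric graph is a geometric graph whose vertices are in convex position, i.e. no vertex lies in the convex hull of the other vertices. There is an algorithm that computes $\mathrm{cr}(G)$ in $O(n^2)$ time for every convex geometric graph $G$ on $n$ vertices. Moreover, if $G=(V,E)$ is a convex geometric graph and $u\in V$, then there are two open rays with apex $u$ and opposite directions that are disjoint from the convex hull of $V$; in particular, no edge of $G$ meets either of the two rays. (b) A layered graph is a geometric graph whose vertex set is partitioned into layers $L_1,\dots,L_r$ such that all vertices of $L_i$ have the same $y$-coordinate $y_i$, $y_1<y_2<\dots<y_r$, and vertices of $L_i$ are adjacent only to vertices of $L_{i-1}$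 and $L_{i+1}$ (vertices of one layer may be collinear). There is an algorithm that computes $\mathrm{cr}(G)$ in $O(n^2)$ time for every layered graph $G$ on $n$ vertices. Consequently, the same algorithm computes $\mathrm{cr}(G)$ in $o(|E|\log|V|)$ time on layered graphs with $\omega(n^2/\log n)$ edges: if $f:\mathbb N\to\mathbb N$ satisfies $n^2/\log n=o(f(n))$, then for every $\varepsilon>0$ there is $n_0$ such that for every $n\ge n_0$ and every layered graph $G$ with $n$ vertices and $|E|\ge f(n)$ the algorithm takes at most $\varepsilon\,|E|\log n$ steps. (c) Let $G$ be a layered graph with layers $L_1,\dots,L_r$ and, for $1\le i\le r-1$, let $G_i$ be the subgraph of $G$ induced by $L_i\cup L_{i+1}$. Then $\mathrm{cr}(G)=\sum_{i=1}^{r-1}\mathrm{cr}(G_i)$. Moreover, for every $i$ and every $\varepsilon>0$ the vertices of $G_i$ can be moved, each by less than $\varepsilon$, to points in convex position in such a way that two edges of $G_i$ cross after the move if and only if they cross before it. -/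

import Mathlib

/-! ### Geometric graphs: a simple graph `G` together with the positions `pos` of its vertices -/

/-- The relative interior of the straight line segment that joins the endpoints of `e`. -/
def edgeInterior {V : Type*} (pos : V → ℝ × ℝ) : Sym2 V → Set (ℝ × ℝ) :=
  Sym2.lift ⟨fun u v => openSegment ℝ (pos u) (pos v), fun _ _ => openSegment_symm ℝ _ _⟩

/-- The closed straight line segment that joins the endpoints of `e`. -/
def edgeSegment {V : Type*} (pos : V → ℝ × ℝ) : Sym2 V → Set (ℝ × ℝ) :=
  Sym2.lift ⟨fun u v => segment ℝ (pos u) (pos v), fun _ _ => segment_symm ℝ _ _⟩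

/-- Two edges cross if they intersect in their interiors. -/
def EdgesCross {V : Type*} (pos : V → ℝ × ℝ) (e f : Sym2 V) : Prop :=
  (edgeInterior pos e ∩ edgeInterior pos f).Nonempty

/-- The number of crossings: the number of unordered pairs of distinct edges that cross. -/
noncomputable def numCrossings {V : Type*} (G : SimpleGraph V) (pos : V → ℝ × ℝ) : ℕ :=
  Set.ncard {p : Sym2 (Sym2 V) | ∃ e f : Sym2 V, p = s(e, f) ∧
    e ∈ G.edgeSet ∧ f ∈ G.edgeSet ∧ e ≠ f ∧ EdgesCross pos e f}

/-- The open ray with apex `p` and direction `d`. -/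
def openRay (p d : ℝ × ℝ) : Set (ℝ × ℝ) := {q | ∃ t : ℝ, 0 < t ∧ q = p + t • d}

/-- The number of edges of the geometric graph that meet the open ray with apex `p` and
direction `d`. -/
noncomputable def rayCount {V : Type*} (G : SimpleGraph V) (pos : V → ℝ × ℝ) (p d : ℝ × ℝ) : ℕ :=
  Set.ncard {e : Sym2 V | e ∈ G.edgeSet ∧ (openRay p d ∩ edgeSegment pos e).Nonempty}

/-- `layer` assigns to each vertex the index of its layer; layer `i` lies on the horizontal line of
height `y i`, heights increase strictly with the index, and edges join consecutive layers only. -/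
structure IsLayering {V : Type*} (G : SimpleGraph V) (pos : V → ℝ × ℝ) {r : ℕ}
    (layer : V → Fin r) (y : Fin r → ℝ) : Prop where
  injective : Function.Injective pos
  strictMono : StrictMono y
  height : ∀ v, (pos v).2 = y (layer v)
  adj : ∀ u v, G.Adj u v →
    (layer u : ℕ) + 1 = (layer v : ℕ) ∨ (layer v : ℕ) + 1 = (layer u : ℕ)

/-- A layered (geometric) graph. -/
def IsLayered {V : Type*} (G : SimpleGraph V) (pos : V → ℝ × ℝ) : Prop :=
  ∃ (r : ℕ) (layer : V → Fin r) (y : Fin r → ℝ), IsLayering G pos layer y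

/-- The vertices in layers `i` and `i + 1` (layers are numbered from `0`). -/
def bilayer {V : Type*} {r : ℕ} (layer : V → Fin r) (i : ℕ) : Set V :=
  {v | (layer v : ℕ) = i ∨ (layer v : ℕ) = i + 1}

/-- The bilayer subgraph: the subgraph induced by layers `i` and `i + 1`. -/
def bilayerGraph {V : Type*} (G : SimpleGraph V) {r : ℕ} (layer : V → Fin r) (i : ℕ) :
    SimpleGraph (bilayer layer i) :=
  G.induce (bilayer layer i)

/-- The positions of the vertices of the bilayer subgraph. -/
def bilayerPos {V : Type*} (pos : V → ℝ × ℝ) {r : ℕ} (layer : V → Fin r) (i : ℕ) :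
    bilayer layer i → ℝ × ℝ :=
  fun v => pos v

/-! ### The machine model: a real RAM

A random access machine with integer memory (natural numbers that fit in a machine word) and real
memory.  Memory is organised in registers and in one-dimensional arrays; a program mentions only
finitely many of them, by fixed names, while array positions are computed at run time (indirect
addressing).  On integers the operations are `+`, truncated `-`, `*` and comparison, on reals they
are `+`, `-`, `*` and comparison; there is no division, no root, no rounding, and no conversion from
reals to integers.  Every operation, memory access and test costs one step. -/

/-- Memory contents. -/
structure RamState where
  /-- integer registers -/
  reg : ℕ → ℕ
  /-- integer arrays: name, then position -/
  iarr : ℕ → ℕ → ℕ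
  /-- real arrays: name, then position -/
  rarr : ℕ → ℕ → ℝ

/-- Integer expressions. -/
inductive IntExpr where
  | const (z : ℕ)
  | reg (x : ℕ)
  | load (a : ℕ) (i : IntExpr)
  | add (e₁ e₂ : IntExpr)
  | sub (e₁ e₂ : IntExpr)
  | mul (e₁ e₂ : IntExpr)

/-- Value of an integer expression. -/
def IntExpr.eval (s : RamState) : IntExpr → ℕ
  | .const z => z
  | .reg x => s.reg x
  | .load a i => s.iarr a (i.eval s)
  | .add e₁ e₂ => e₁.eval s + e₂.eval s
  | .sub e₁ e₂ => e₁.eval s - e₂.eval s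
  | .mul e₁ e₂ => e₁.eval s * e₂.eval s

/-- Number of steps taken to evaluate an integer expression. -/
def IntExpr.cost : IntExpr → ℕ
  | .const _ => 1
  | .reg _ => 1
  | .load _ i => i.cost + 1
  | .add e₁ e₂ => e₁.cost + e₂.cost + 1
  | .sub e₁ e₂ => e₁.cost + e₂.cost + 1
  | .mul e₁ e₂ => e₁.cost + e₂.cost + 1

/-- Real expressions. -/
inductive RealExpr where
  | const (z : ℤ)
  | load (a : ℕ) (i : IntExpr)
  | add (e₁ e₂ : RealExpr)
  | sub (e₁ e₂ : RealExpr)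
  | mul (e₁ e₂ : RealExpr)

/-- Value of a real expression. -/
noncomputable def RealExpr.eval (s : RamState) : RealExpr → ℝ
  | .const z => (z : ℝ)
  | .load a i => s.rarr a (i.eval s)
  | .add e₁ e₂ => e₁.eval s + e₂.eval s
  | .sub e₁ e₂ => e₁.eval s - e₂.eval s
  | .mul e₁ e₂ => e₁.eval s * e₂.eval s

/-- Number of steps taken to evaluate a real expression. -/
def RealExpr.cost : RealExpr → ℕ
  | .const _ => 1
  | .load _ i => i.cost + 1
  | .add e₁ e₂ => e₁.cost + e₂.cost + 1
  | .sub e₁ e₂ => e₁.cost + e₂.cost + 1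
  | .mul e₁ e₂ => e₁.cost + e₂.cost + 1

/-- Tests. -/
inductive RamTest where
  | intLt (e₁ e₂ : IntExpr)
  | realLt (e₁ e₂ : RealExpr)
  | not (b : RamTest)
  | and (b₁ b₂ : RamTest)

/-- Outcome of a test. -/
def RamTest.Holds (s : RamState) : RamTest → Prop
  | .intLt e₁ e₂ => e₁.eval s < e₂.eval s
  | .realLt e₁ e₂ => e₁.eval s < e₂.eval s
  | .not b => ¬ b.Holds s
  | .and b₁ b₂ => b₁.Holds s ∧ b₂.Holds s

/-- Number of steps taken by a test. -/
def RamTest.cost : RamTest → ℕ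
  | .intLt e₁ e₂ => e₁.cost + e₂.cost + 1
  | .realLt e₁ e₂ => e₁.cost + e₂.cost + 1
  | .not b => b.cost + 1
  | .and b₁ b₂ => b₁.cost + b₂.cost + 1

/-- Programs. -/
inductive RamProgram where
  | skip
  | setReg (x : ℕ) (e : IntExpr)
  | storeInt (a : ℕ) (i e : IntExpr)
  | storeReal (a : ℕ) (i : IntExpr) (e : RealExpr)
  | seq (c d : RamProgram)
  | branch (b : RamTest) (c d : RamProgram)
  | loop (b : RamTest) (c : RamProgram)

/-- `RamExec W c s t s'`: on a machine whose integer memory cells hold only numbers up to `W`,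
the program `c`, started in `s`, halts in `s'` after exactly `t` steps.  Storing an integer
larger than `W` is a fault: the execution has no final state. -/
inductive RamExec (W : ℕ) : RamProgram → RamState → ℕ → RamState → Prop where
  | skip (s : RamState) : RamExec W .skip s 1 s
  | setReg (s : RamState) (x : ℕ) (e : IntExpr) (h : e.eval s ≤ W) :
      RamExec W (.setReg x e) s (e.cost + 1)
        { s with reg := Function.update s.reg x (e.eval s) }
  | storeInt (s : RamState) (a : ℕ) (i e : IntExpr) (h : e.eval s ≤ W) :
      RamExec W (.storeInt a i e) s (i.cost + e.cost + 1)
        { s with iarr :=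
            Function.update s.iarr a (Function.update (s.iarr a) (i.eval s) (e.eval s)) }
  | storeReal (s : RamState) (a : ℕ) (i : IntExpr) (e : RealExpr) :
      RamExec W (.storeReal a i e) s (i.cost + e.cost + 1)
        { s with rarr :=
            Function.update s.rarr a (Function.update (s.rarr a) (i.eval s) (e.eval s)) }
  | seq {c d : RamProgram} {s s' s'' : RamState} {t t' : ℕ}
      (hc : RamExec W c s t s') (hd : RamExec W d s' t' s'') :
      RamExec W (.seq c d) s (t + t') s''
  | branchTrue {b : RamTest} {c d : RamProgram} {s s' : RamState} {t : ℕ}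
      (hb : b.Holds s) (hc : RamExec W c s t s') :
      RamExec W (.branch b c d) s (b.cost + t) s'
  | branchFalse {b : RamTest} {c d : RamProgram} {s s' : RamState} {t : ℕ}
      (hb : ¬ b.Holds s) (hd : RamExec W d s t s') :
      RamExec W (.branch b c d) s (b.cost + t) s'
  | loopDone {b : RamTest} {c : RamProgram} {s : RamState} (hb : ¬ b.Holds s) :
      RamExec W (.loop b c) s b.cost s
  | loopStep {b : RamTest} {c : RamProgram} {s s' s'' : RamState} {t t' : ℕ}
      (hb : b.Holds s) (hc : RamExec W c s t s') (hl : RamExec W (.loop b c) s' t' s'') :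
      RamExec W (.loop b c) s (b.cost + t + t') s''

open Classical in
/-- The input: register `0` holds `n`, integer array `0` holds the adjacency matrix row by row,
real arrays `0` and `1` hold the `x`- and the `y`-coordinates of the vertices, and everything else
is `0`. -/
noncomputable def ramInput {n : ℕ} (G : SimpleGraph (Fin n)) (pos : Fin n → ℝ × ℝ) : RamState where
  reg := fun x => if x = 0 then n else 0
  iarr := fun a p =>
    if a = 0 ∧ ∃ i j : Fin n, p = (i : ℕ) * n + (j : ℕ) ∧ G.Adj i j then 1 else 0
  rarr := fun a p =>
    if h : p < n then
      if a = 0 then (pos ⟨p, h⟩).1 else if a = 1 then (pos ⟨p, h⟩).2 else 0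
    else 0

/-- On the geometric graph `(G, pos)` with `n` vertices, the program `P` halts after exactly `t`
steps with the number of crossings in register `1`.  All stored integers are at most `(n + 2) ^ k`,
that is, for fixed `k` machine words have `O(log n)` bits. -/
def CountsCrossingsIn (P : RamProgram) (k : ℕ) {n : ℕ} (G : SimpleGraph (Fin n))
    (pos : Fin n → ℝ × ℝ) (t : ℕ) : Prop :=
  ∃ s : RamState, RamExec ((n + 2) ^ k) P (ramInput G pos) t s ∧ s.reg 1 = numCrossings G pos

/-!
Number the vertices counterclockwise around the hull, starting at vertex `0`, respectively from the
lowest to the highest and from left to right at each height. Counting predecessors finds this order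
in quadratic time. Edges `ab` and `cd` with `a < b`, `c < d` and `a < c` then cross if and only if
`c < b < d` in the convex case, and if and only if `d < b` in the layered case, where `c < b` is
then automatic. Hence for each pair `c < d` it suffices to know how many edges join a rank below `c`
to a rank between `c` and `d`, respectively to a rank above `d`. For fixed `c`, a running sum over
the ranks above `c`, in increasing respectively decreasing order, yields these numbers in linear
time, since the number of edges from below `c` to each rank can be updated as `c` increases.

Each vertex `u` in convex position is the strict minimum of a linear functional over the convex
hull, and the rays from `u` along its kernel miss the hull.

Crossing edges of a layered graph join the same two layers. Bending two parallel lines slightly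
towards each other into parabolas brings their points into convex position, and small perturbations
keep the crossings, since these depend only on the orientations of the triangles formed by an edge
and a third vertex, none of which is degenerate.
-/

/-! ### Orientation and crossings -/

/-- Twice the signed area of the triangle `a b c`: positive if and only if the triangle is
traversed counterclockwise. -/
def orient (a b c : ℝ × ℝ) : ℝ := (b.1 - a.1) * (c.2 - a.2) - (b.2 - a.2) * (c.1 - a.1)

theorem orient_rotate (a b c : ℝ × ℝ) : orient b c a = orient a b c := by
  unfold orient
  ring

theorem orient_swap (a b c : ℝ × ℝ) : orient a c b = -orient a b c := by
  unfold orient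
  ring

theorem orient_self_left (a b : ℝ × ℝ) : orient a a b = 0 := by
  unfold orient
  ring

theorem orient_self_right (a b : ℝ × ℝ) : orient a b b = 0 := by
  unfold orient
  ring

theorem orient_self_outer (a b : ℝ × ℝ) : orient a b a = 0 := by
  unfold orient
  ring

theorem orient_smul_add_smul (a b c d : ℝ × ℝ) {s t : ℝ} (h : s + t = 1) :
    orient a b (s • c + t • d) = s * orient a b c + t * orient a b d := by
  obtain rfl : s = 1 - t := by linarith
  simp only [orient, Prod.fst_add, Prod.snd_add, Prod.smul_fst, Prod.smul_snd, smul_eq_mul]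
  ring

theorem orient_sub_orient (a b c d : ℝ × ℝ) :
    orient c d b - orient c d a = orient a b c - orient a b d := by
  unfold orient
  ring

theorem orient_eq_zero_of_mem_openSegment {a b p : ℝ × ℝ} (h : p ∈ openSegment ℝ a b) :
    orient a b p = 0 := by
  obtain ⟨s, t, -, -, hst, rfl⟩ := h
  rw [orient_smul_add_smul a b a b hst, orient_self_outer, orient_self_right, mul_zero, mul_zero,
    add_zero]

theorem mul_neg_of_add_eq_zero {s t x y : ℝ} (hs : 0 < s) (ht : 0 < t)
    (h : s * x + t * y = 0) (hxy : x ≠ 0 ∨ y ≠ 0) : x * y < 0 := by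
  rcases lt_trichotomy x 0 with hx | rfl | hx
  · exact mul_neg_of_neg_of_pos hx (pos_of_mul_pos_right (by nlinarith : 0 < t * y) ht.le)
  · simp_all [ht.ne']
  · exact mul_neg_of_pos_of_neg hx (neg_of_mul_neg_right (by nlinarith : t * y < 0) ht.le)

theorem orient_mul_orient_neg_of_openSegment_inter {a b c d : ℝ × ℝ}
    (h : (openSegment ℝ a b ∩ openSegment ℝ c d).Nonempty)
    (hcd : orient a b c ≠ 0 ∨ orient a b d ≠ 0) : orient a b c * orient a b d < 0 := by
  obtain ⟨p, hp, s, t, hs, ht, hst, rfl⟩ := h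
  have hp := orient_eq_zero_of_mem_openSegment hp
  rw [orient_smul_add_smul _ _ _ _ hst] at hp
  exact mul_neg_of_add_eq_zero hs ht hp hcd

theorem div_sub_pos_of_mul_neg {x y : ℝ} (h : x * y < 0) :
    0 < y / (y - x) ∧ 0 < -x / (y - x) := by
  rcases mul_neg_iff.mp h with ⟨hx, hy⟩ | ⟨hx, hy⟩
  · exact ⟨div_pos_of_neg_of_neg hy (by linarith),
      div_pos_of_neg_of_neg (by linarith) (by linarith)⟩
  · exact ⟨div_pos hy (by linarith), div_pos (by linarith) (by linarith)⟩

theorem openSegment_inter_nonempty_of_orient {a b c d : ℝ × ℝ}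
    (hcd : orient a b c * orient a b d < 0) (hab : orient c d a * orient c d b < 0) :
    (openSegment ℝ a b ∩ openSegment ℝ c d).Nonempty := by
  obtain ⟨ha, hb⟩ := div_sub_pos_of_mul_neg hab
  obtain ⟨hd, hc⟩ := div_sub_pos_of_mul_neg (mul_comm (orient a b c) _ ▸ hcd)
  rw [← orient_sub_orient] at hd hc
  have hD : orient c d b - orient c d a ≠ 0 := fun h => by simp [h] at ha
  -- The weights of `a` and `b` at the common point are proportional to the distances of `b` and `a`
  -- from the line `c d`.
  refine ⟨_, ⟨_, _, ha, hb, ?_, rfl⟩, ⟨_, _, hc, hd, ?_, ?_⟩⟩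
  · rw [← add_div, ← sub_eq_add_neg, div_self hD]
  · rw [← add_div, neg_add_eq_sub, ← orient_sub_orient, div_self hD]
  · ext <;> simp only [Prod.fst_add, Prod.snd_add, Prod.smul_fst, Prod.smul_snd, smul_eq_mul] <;>
      field_simp <;> unfold orient <;> ring

theorem collinear_of_orient_eq_zero {a b c : ℝ × ℝ} (h : orient a b c = 0) :
    Collinear ℝ {a, b, c} := by
  rcases eq_or_ne a b with rfl | hab
  · simpa using collinear_pair ℝ a c
  have hlen : (b.1 - a.1) ^ 2 + (b.2 - a.2) ^ 2 ≠ 0 := fun h0 => hab <| Prod.ext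
    (by nlinarith [sq_nonneg (b.1 - a.1), sq_nonneg (b.2 - a.2)])
    (by nlinarith [sq_nonneg (b.1 - a.1), sq_nonneg (b.2 - a.2)])
  -- The third point has the parameter `⟪c - a, b - a⟫ / ‖b - a‖ ^ 2` on the line `a b`.
  have hc : c = (((c.1 - a.1) * (b.1 - a.1) + (c.2 - a.2) * (b.2 - a.2)) /
      ((b.1 - a.1) ^ 2 + (b.2 - a.2) ^ 2)) • (b - a) + a := by
    unfold orient at h
    ext <;> simp only [Prod.fst_add, Prod.snd_add, Prod.smul_fst, Prod.smul_snd, Prod.fst_sub,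
      Prod.snd_sub, smul_eq_mul] <;> field_simp
    · linear_combination -(b.2 - a.2) * h
    · linear_combination (b.1 - a.1) * h
  refine (collinear_iff_of_mem (p₀ := a) (by simp)).mpr ⟨b - a, ?_⟩
  simp only [Set.mem_insert_iff, Set.mem_singleton_iff, vadd_eq_add, forall_eq_or_imp, forall_eq]
  exact ⟨⟨0, by simp⟩, ⟨1, by simp⟩, _, hc⟩

theorem mem_segment_or_of_orient_eq_zero {a b c : ℝ × ℝ} (h : orient a b c = 0) :
    b ∈ segment ℝ a c ∨ c ∈ segment ℝ b a ∨ a ∈ segment ℝ c b := by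
  simpa only [mem_segment_iff_wbtw] using
    (collinear_of_orient_eq_zero h).wbtw_or_wbtw_or_wbtw

theorem mem_convexHull_of_orient {a b c p : ℝ × ℝ} (h : 0 < orient a b c)
    (hab : 0 ≤ orient a b p) (hbc : 0 ≤ orient b c p) (hca : 0 ≤ orient c a p) :
    p ∈ convexHull ℝ {a, b, c} := by
  have hsum : orient b c p + orient c a p + orient a b p = orient a b c := by
    unfold orient
    ring
  -- The barycentric coordinates of `p` are ratios of areas.
  refine mem_convexHull_of_exists_fintype
    (fun i : Fin 3 => ![orient b c p, orient c a p, orient a b p] i / orient a b c) ![a, b, c]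
    (fun i => div_nonneg ?_ h.le) ?_ (fun i => ?_) ?_
  · fin_cases i <;> assumption
  · rw [← Finset.sum_div, Fin.sum_univ_three]
    exact (div_eq_one_iff_eq h.ne').mpr hsum
  · fin_cases i <;> simp
  · have h0 := h.ne'
    rw [Fin.sum_univ_three]
    ext <;> simp only [Prod.fst_add, Prod.snd_add, Prod.smul_fst, Prod.smul_snd, smul_eq_mul,
      Matrix.cons_val] <;> field_simp <;> unfold orient <;> ring

theorem edgesCross_mk {V : Type*} (pos : V → ℝ × ℝ) (a b c d : V) :
    EdgesCross pos s(a, b) s(c, d) ↔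
      (openSegment ℝ (pos a) (pos b) ∩ openSegment ℝ (pos c) (pos d)).Nonempty :=
  Iff.rfl

theorem EdgesCross.symm {V : Type*} {pos : V → ℝ × ℝ} {e f : Sym2 V} (h : EdgesCross pos e f) :
    EdgesCross pos f e := by
  rwa [EdgesCross, Set.inter_comm]

theorem edgesCross_self {V : Type*} (pos : V → ℝ × ℝ) (e : Sym2 V) : EdgesCross pos e e := by
  induction e with
  | h a b =>
    rw [edgesCross_mk, Set.inter_self]
    exact ⟨_, 1 / 2, 1 / 2, by norm_num, by norm_num, by norm_num, rfl⟩

theorem edgesCross_map {V W : Type*} (f : W → V) (pos : V → ℝ × ℝ) (e e' : Sym2 W) :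
    EdgesCross pos (e.map f) (e'.map f) ↔ EdgesCross (pos ∘ f) e e' := by
  induction e with
  | h a b =>
    induction e' with
    | h c d => rfl

theorem edgesCross_iff_orient {V : Type*} {pos : V → ℝ × ℝ} {a b c d : V}
    (hcd : orient (pos a) (pos b) (pos c) ≠ 0 ∨ orient (pos a) (pos b) (pos d) ≠ 0)
    (hab : orient (pos c) (pos d) (pos a) ≠ 0 ∨ orient (pos c) (pos d) (pos b) ≠ 0) :
    EdgesCross pos s(a, b) s(c, d) ↔
      orient (pos a) (pos b) (pos c) * orient (pos a) (pos b) (pos d) < 0 ∧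
        orient (pos c) (pos d) (pos a) * orient (pos c) (pos d) (pos b) < 0 :=
  ⟨fun h => ⟨orient_mul_orient_neg_of_openSegment_inter h hcd,
    orient_mul_orient_neg_of_openSegment_inter h.symm hab⟩,
    fun h => openSegment_inter_nonempty_of_orient h.1 h.2⟩

theorem not_edgesCross_of_common {V : Type*} {pos : V → ℝ × ℝ} {a b d : V}
    (h : orient (pos a) (pos b) (pos d) ≠ 0) : ¬ EdgesCross pos s(a, b) s(a, d) := by
  rw [edgesCross_iff_orient (Or.inr h) (Or.inr (by rwa [orient_swap, neg_ne_zero])),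
    orient_self_outer, zero_mul]
  exact fun h => lt_irrefl _ h.1

/-! ### Convex position -/

section ConvexPosition

variable {V : Type*} {pos : V → ℝ × ℝ}

theorem ne_of_orient_ne_zero {a b c : V} (h : orient (pos a) (pos b) (pos c) ≠ 0) :
    a ≠ b ∧ a ≠ c ∧ b ≠ c := by
  refine ⟨?_, ?_, ?_⟩ <;> rintro rfl
  exacts [h (orient_self_left _ _), h (orient_self_outer _ _), h (orient_self_right _ _)]

theorem orient_ne_zero_of_convexIndependent (h : ConvexIndependent ℝ pos) {u v w : V}
    (huv : u ≠ v) (huw : u ≠ w) (hvw : v ≠ w) : orient (pos u) (pos v) (pos w) ≠ 0 := by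
  have key : ∀ a b c : V, pos c ∈ segment ℝ (pos a) (pos b) → c = a ∨ c = b := fun a b c hc =>
    h {a, b} c (by rwa [Set.image_pair, convexHull_pair])
  intro h0
  rcases mem_segment_or_of_orient_eq_zero h0 with h1 | h1 | h1
  · exact (key _ _ _ h1).elim huv.symm hvw
  · exact (key _ _ _ h1).elim hvw.symm huw.symm
  · exact (key _ _ _ h1).elim huw huv

theorem orient_neg_of_convexIndependent (h : ConvexIndependent ℝ pos) {a b c p : V}
    (hpa : p ≠ a) (hpb : p ≠ b) (hpc : p ≠ c) (habc : 0 < orient (pos a) (pos b) (pos c))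
    (habp : 0 ≤ orient (pos a) (pos b) (pos p)) (hbcp : 0 ≤ orient (pos b) (pos c) (pos p)) :
    orient (pos c) (pos a) (pos p) < 0 := by
  by_contra! hcap
  have hp : p ∈ ({a, b, c} : Set V) := h {a, b, c} p <| by
    rw [Set.image_insert_eq, Set.image_pair]
    exact mem_convexHull_of_orient habc habp hbcp hcap
  simp [hpa, hpb, hpc] at hp

theorem orient_pos_trans (h : ConvexIndependent ℝ pos) {o u v w : V}
    (huv : 0 < orient (pos o) (pos u) (pos v)) (hvw : 0 < orient (pos o) (pos v) (pos w)) :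
    0 < orient (pos o) (pos u) (pos w) := by
  obtain ⟨hou, hov, -⟩ := ne_of_orient_ne_zero huv.ne'
  obtain ⟨-, how, -⟩ := ne_of_orient_ne_zero hvw.ne'
  by_contra! huw
  -- Otherwise `o` lies in the triangle `u v w`.
  have huvw : 0 < orient (pos u) (pos v) (pos w) := by
    have e : orient (pos u) (pos v) (pos w) = orient (pos o) (pos u) (pos v) +
        orient (pos o) (pos v) (pos w) - orient (pos o) (pos u) (pos w) := by
      unfold orient
      ring
    linarith
  have hwuo := orient_neg_of_convexIndependent h hou hov how huvw
    (by rw [orient_rotate]; exact huv.le) (by rw [orient_rotate]; exact hvw.le)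
  rw [orient_rotate, orient_swap] at hwuo
  linarith

theorem orient_pos_of_consecutive (h : ConvexIndependent ℝ pos) {o u v w : V}
    (huv : 0 < orient (pos o) (pos u) (pos v)) (hvw : 0 < orient (pos o) (pos v) (pos w)) :
    0 < orient (pos u) (pos v) (pos w) := by
  obtain ⟨-, hov, huv'⟩ := ne_of_orient_ne_zero huv.ne'
  obtain ⟨-, -, hvw'⟩ := ne_of_orient_ne_zero hvw.ne'
  by_contra! huvw
  -- Otherwise `v` lies in the triangle `o u w`.
  have hwov := orient_neg_of_convexIndependent h hov.symm huv'.symm hvw'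
    (orient_pos_trans h huv hvw) huv.le (by rw [orient_swap]; linarith)
  rw [← orient_rotate] at hwov
  linarith

/-- Vertex `u` precedes vertex `v` in the counterclockwise order around the convex hull that
starts at vertex `o`. -/
def CcwBefore (pos : V → ℝ × ℝ) (o u v : V) : Prop :=
  (u = o ∧ v ≠ o) ∨ 0 < orient (pos o) (pos u) (pos v)

theorem isStrictTotalOrder_ccwBefore (h : ConvexIndependent ℝ pos) (o : V) :
    IsStrictTotalOrder V (CcwBefore pos o) where
  irrefl u := by simp [CcwBefore, orient_self_right]
  trans := by
    rintro u v w (⟨rfl, -⟩ | huv) (⟨rfl, hw⟩ | hvw)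
    · exact Or.inl ⟨rfl, hw⟩
    · exact Or.inl ⟨rfl, (ne_of_orient_ne_zero hvw.ne').2.1.symm⟩
    · exact absurd rfl (ne_of_orient_ne_zero huv.ne').2.1
    · exact Or.inr (orient_pos_trans h huv hvw)
  trichotomous u v huv hvu := by
    simp only [CcwBefore, not_or, not_and, not_not, not_lt] at huv hvu
    by_contra hne
    have hu : u ≠ o := fun hu => hne (hu.trans (huv.1 hu).symm)
    have hv : v ≠ o := fun hv => hne ((hvu.1 hv).trans hv.symm)
    have h0 := orient_ne_zero_of_convexIndependent h hu.symm hv.symm hne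
    rw [orient_swap] at hvu
    exact h0 (le_antisymm huv.2 (by linarith [hvu.2]))

theorem orient_pos_of_ccwBefore (h : ConvexIndependent ℝ pos) {o u v w : V}
    (huv : CcwBefore pos o u v) (hvw : CcwBefore pos o v w) :
    0 < orient (pos u) (pos v) (pos w) := by
  have hv : v ≠ o := huv.elim And.right fun h => (ne_of_orient_ne_zero h.ne').2.1.symm
  have hvw := hvw.resolve_left fun h => hv h.1
  rcases huv with ⟨rfl, -⟩ | huv
  · exact hvw
  · exact orient_pos_of_consecutive h huv hvw

end ConvexPosition

theorem exists_equiv_fin_lt_iff {α : Type*} [Fintype α] {n : ℕ} (hn : Fintype.card α = n)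
    (r : α → α → Prop) [IsStrictTotalOrder α r] :
    ∃ σ : Fin n ≃ α, ∀ i j, r (σ i) (σ j) ↔ i < j := by
  classical
  let := linearOrderOfSTO r
  exact ⟨(Fintype.orderIsoFinOfCardEq α hn).toEquiv,
    fun _ _ => (Fintype.orderIsoFinOfCardEq α hn).lt_iff_lt⟩

/-! ### Crossing pairs -/

section CrossingPairs

variable {V W : Type*}

/-- The set of unordered pairs of distinct crossing edges, whose cardinality is
`numCrossings G pos`. -/
def crossingPairs (G : SimpleGraph V) (pos : V → ℝ × ℝ) : Set (Sym2 (Sym2 V)) :=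
  {p | ∃ e f : Sym2 V, p = s(e, f) ∧
    e ∈ G.edgeSet ∧ f ∈ G.edgeSet ∧ e ≠ f ∧ EdgesCross pos e f}

theorem numCrossings_eq_ncard (G : SimpleGraph V) (pos : V → ℝ × ℝ) :
    numCrossings G pos = (crossingPairs G pos).ncard :=
  rfl

theorem mk_mem_crossingPairs {G : SimpleGraph V} {pos : V → ℝ × ℝ} {e f : Sym2 V} :
    s(e, f) ∈ crossingPairs G pos ↔
      e ∈ G.edgeSet ∧ f ∈ G.edgeSet ∧ e ≠ f ∧ EdgesCross pos e f := by
  constructor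
  · rintro ⟨e', f', h, he, hf, hef, hcross⟩
    rcases Sym2.eq_iff.mp h with ⟨rfl, rfl⟩ | ⟨rfl, rfl⟩
    exacts [⟨he, hf, hef, hcross⟩, ⟨hf, he, hef.symm, hcross.symm⟩]
  · rintro ⟨he, hf, hef, hcross⟩
    exact ⟨e, f, rfl, he, hf, hef, hcross⟩

theorem map_mem_edgeSet_iff (G : SimpleGraph V) (f : W → V) (e : Sym2 W) :
    e.map f ∈ G.edgeSet ↔ e ∈ (G.comap f).edgeSet := by
  induction e with
  | h a b => rfl

theorem preimage_crossingPairs (G : SimpleGraph V) (pos : V → ℝ × ℝ) {f : W → V}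
    (hf : Function.Injective f) :
    Sym2.map (Sym2.map f) ⁻¹' crossingPairs G pos = crossingPairs (G.comap f) (pos ∘ f) := by
  ext p
  induction p with
  | h d e =>
    simp only [Set.mem_preimage, Sym2.map_mk, mk_mem_crossingPairs, map_mem_edgeSet_iff,
      edgesCross_map, ne_eq, (Sym2.map.injective hf).eq_iff]

theorem numCrossings_comap (G : SimpleGraph V) (pos : V → ℝ × ℝ) {f : W → V}
    (hf : Function.Injective f) :
    numCrossings (G.comap f) (pos ∘ f) =
      (crossingPairs G pos ∩ Set.range (Sym2.map (Sym2.map f))).ncard := by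
  rw [numCrossings_eq_ncard, ← preimage_crossingPairs G pos hf,
    ← Set.ncard_image_of_injective _ (Sym2.map.injective (Sym2.map.injective hf)),
    Set.image_preimage_eq_inter_range]

theorem mem_range_map_iff {f : W → V} {e : Sym2 V} :
    e ∈ Set.range (Sym2.map f) ↔ ∀ v ∈ e, v ∈ Set.range f := by
  constructor
  · rintro ⟨e, rfl⟩ v hv
    obtain ⟨w, -, rfl⟩ := Sym2.mem_map.mp hv
    exact ⟨w, rfl⟩
  · induction e with
    | h a b =>
      intro h
      obtain ⟨a, rfl⟩ := h _ (Sym2.mem_mk_left _ _)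
      obtain ⟨b, rfl⟩ := h _ (Sym2.mem_mk_right _ _)
      exact ⟨s(a, b), rfl⟩

theorem numCrossings_comap_equiv (G : SimpleGraph V) (pos : V → ℝ × ℝ) (σ : W ≃ V) :
    numCrossings (G.comap σ) (pos ∘ σ) = numCrossings G pos := by
  have hrange : Set.range (Sym2.map (Sym2.map σ)) = Set.univ :=
    Set.eq_univ_of_forall fun p => by simp only [mem_range_map_iff, σ.range_eq_univ, Set.mem_univ,
      implies_true]
  rw [numCrossings_comap G pos σ.injective, hrange, Set.inter_univ, numCrossings_eq_ncard]

theorem numCrossings_induce (G : SimpleGraph V) (pos : V → ℝ × ℝ) (S : Set V) :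
    numCrossings (G.induce S) (fun v => pos v) =
      (crossingPairs G pos ∩ {p | ∀ e ∈ p, ∀ v ∈ e, v ∈ S}).ncard := by
  refine (numCrossings_comap G pos Subtype.val_injective).trans ?_
  congr
  ext p
  simp only [mem_range_map_iff, Subtype.range_coe, Set.mem_ofPred_eq]

theorem numCrossings_eq_sum_induce [Finite V] {ι : Type*} {I : Finset ι} {S : ι → Set V}
    (G : SimpleGraph V) (pos : V → ℝ × ℝ)
    (hS : ∀ p ∈ crossingPairs G pos, ∃! i, i ∈ I ∧ ∀ e ∈ p, ∀ v ∈ e, v ∈ S i) :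
    numCrossings G pos = ∑ i ∈ I, numCrossings (G.induce (S i)) fun v => pos v := by
  have hunion : crossingPairs G pos =
      ⋃ i ∈ (I : Set ι), crossingPairs G pos ∩ {p | ∀ e ∈ p, ∀ v ∈ e, v ∈ S i} := by
    ext p
    simp only [Set.mem_iUnion, Set.mem_inter_iff, exists_prop]
    exact ⟨fun hp => (hS p hp).exists.imp fun i hi => ⟨hi.1, hp, hi.2⟩, fun ⟨_, _, hp, _⟩ => hp⟩
  have hdisj : (I : Set ι).PairwiseDisjoint
      fun i => crossingPairs G pos ∩ {p | ∀ e ∈ p, ∀ v ∈ e, v ∈ S i} :=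
    fun i hi j hj hij => Set.disjoint_left.mpr fun p hpi hpj =>
      hij ((hS p hpi.1).unique ⟨hi, hpi.2⟩ ⟨hj, hpj.2⟩)
  rw [numCrossings_eq_ncard, hunion, I.finite_toSet.ncard_biUnion (fun _ _ => Set.toFinite _) hdisj,
    finsum_mem_coe_finset]
  simp only [numCrossings_induce]

theorem exists_mk_eq_of_mem_edgeSet [LinearOrder V] {G : SimpleGraph V} {e : Sym2 V}
    (he : e ∈ G.edgeSet) : ∃ a b, e = s(a, b) ∧ G.Adj a b ∧ a < b := by
  induction e with
  | h a b =>
    have hab : G.Adj a b := he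
    rcases hab.ne.lt_or_gt with h | h
    · exact ⟨a, b, rfl, hab, h⟩
    · exact ⟨b, a, Sym2.eq_swap, hab.symm, h⟩

theorem mk_eq_mk_iff_of_lt [LinearOrder V] {a b c d : V} (hab : a < b) (hcd : c < d) :
    s(a, b) = s(c, d) ↔ a = c ∧ b = d := by
  refine Sym2.eq_iff.trans (or_iff_left ?_)
  rintro ⟨rfl, rfl⟩
  exact hab.asymm hcd

/-- The crossing pairs of edges in normal form `((a, b), (c, d))`: each edge starts with its lower
endpoint, and the edge with the lower starting point comes first. -/
def crossingQuadruples [LinearOrder V] (G : SimpleGraph V) (pos : V → ℝ × ℝ) :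
    Set ((V × V) × V × V) :=
  {q | G.Adj q.1.1 q.1.2 ∧ G.Adj q.2.1 q.2.2 ∧ q.1.1 < q.1.2 ∧ q.2.1 < q.2.2 ∧ q.1.1 < q.2.1 ∧
    EdgesCross pos s(q.1.1, q.1.2) s(q.2.1, q.2.2)}

theorem numCrossings_eq_ncard_crossingQuadruples [LinearOrder V] {G : SimpleGraph V}
    {pos : V → ℝ × ℝ}
    (hshare : ∀ a b d, G.Adj a b → G.Adj a d → a < b → a < d → b ≠ d →
      ¬ EdgesCross pos s(a, b) s(a, d)) :
    numCrossings G pos = (crossingQuadruples G pos).ncard := by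
  let f : (V × V) × V × V → Sym2 (Sym2 V) := fun q => s(s(q.1.1, q.1.2), s(q.2.1, q.2.2))
  have hinj : Set.InjOn f (crossingQuadruples G pos) := by
    rintro ⟨⟨a, b⟩, c, d⟩ ⟨-, -, hab, hcd, hac, -⟩ ⟨⟨a', b'⟩, c', d'⟩ ⟨-, -, hab', hcd', hac', -⟩ h
    rcases Sym2.eq_iff.mp h with ⟨h₁, h₂⟩ | ⟨h₁, h₂⟩
    · obtain ⟨rfl, rfl⟩ := (mk_eq_mk_iff_of_lt hab hab').mp h₁
      obtain ⟨rfl, rfl⟩ := (mk_eq_mk_iff_of_lt hcd hcd').mp h₂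
      rfl
    · obtain ⟨rfl, rfl⟩ := (mk_eq_mk_iff_of_lt hab hcd').mp h₁
      obtain ⟨rfl, rfl⟩ := (mk_eq_mk_iff_of_lt hcd hab').mp h₂
      exact absurd hac hac'.asymm
  have himage : f '' crossingQuadruples G pos = crossingPairs G pos := by
    refine Set.Subset.antisymm ?_ ?_
    · rintro _ ⟨⟨⟨a, b⟩, c, d⟩, ⟨hadj, hadj', hab, hcd, hac, hcross⟩, rfl⟩
      exact ⟨_, _, rfl, hadj, hadj', fun h => hac.ne ((mk_eq_mk_iff_of_lt hab hcd).mp h).1, hcross⟩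
    · rintro _ ⟨x, y, rfl, hx, hy, hxy, hcross⟩
      obtain ⟨a, b, rfl, hadj, hab⟩ := exists_mk_eq_of_mem_edgeSet hx
      obtain ⟨c, d, rfl, hadj', hcd⟩ := exists_mk_eq_of_mem_edgeSet hy
      rcases lt_trichotomy a c with hac | rfl | hac
      · exact ⟨((a, b), c, d), ⟨hadj, hadj', hab, hcd, hac, hcross⟩, rfl⟩
      · exact absurd hcross (hshare a b d hadj hadj' hab hcd fun h => hxy (h ▸ rfl))
      · exact ⟨((c, d), a, b), ⟨hadj', hadj, hcd, hab, hac, hcross.symm⟩, Sym2.eq_swap⟩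
  rw [numCrossings_eq_ncard, ← himage, hinj.ncard_image]

end CrossingPairs

/-! ### Convex and layered orders -/

theorem edgesCross_iff_of_forall_orient_pos {V : Type*} [LinearOrder V] {pos : V → ℝ × ℝ}
    (hpos : ∀ u v w, u < v → v < w → 0 < orient (pos u) (pos v) (pos w))
    {a b c d : V} (hab : a < b) (hcd : c < d) (hac : a < c) :
    EdgesCross pos s(a, b) s(c, d) ↔ c < b ∧ b < d := by
  have hacd := hpos a c d hac hcd
  have hcda : 0 < orient (pos c) (pos d) (pos a) := by rwa [orient_rotate]
  have hneg : ∀ u v w, u < v → v < w → orient (pos u) (pos w) (pos v) < 0 := fun u v w huv hvw => by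
    rw [orient_swap]
    exact neg_neg_of_pos (hpos u v w huv hvw)
  rcases lt_trichotomy b c with hbc | rfl | hcb
  · have habc := hpos a b c hab hbc
    have habd := hpos a b d hab (hbc.trans hcd)
    rw [edgesCross_iff_orient (Or.inl habc.ne') (Or.inl hcda.ne')]
    exact iff_of_false (fun h => h.1.asymm (mul_pos habc habd)) fun h => h.1.asymm hbc
  · rw [edgesCross_iff_orient (Or.inr hacd.ne') (Or.inl hcda.ne'), orient_self_right, zero_mul]
    exact iff_of_false (fun h => lt_irrefl _ h.1) fun h => lt_irrefl _ h.1
  have habc := hneg a c b hac hcb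
  rw [edgesCross_iff_orient (Or.inl habc.ne) (Or.inl hcda.ne')]
  rcases lt_trichotomy b d with hbd | rfl | hdb
  · exact iff_of_true ⟨mul_neg_of_neg_of_pos habc (hpos a b d hab hbd),
      mul_neg_of_pos_of_neg hcda (hneg c b d hcb hbd)⟩ ⟨hcb, hbd⟩
  · rw [orient_self_right, mul_zero]
    exact iff_of_false (fun h => lt_irrefl _ h.1) fun h => lt_irrefl _ h.2
  · exact iff_of_false (fun h => h.1.asymm (mul_pos_of_neg_of_neg habc
      (hneg a d b (hac.trans hcd) hdb))) fun h => h.2.asymm hdb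

section Layers

variable {V : Type*} {pos : V → ℝ × ℝ}

theorem snd_mem_Ioo_of_mem_openSegment {a b p : ℝ × ℝ} (hab : a.2 < b.2)
    (hp : p ∈ openSegment ℝ a b) : p.2 ∈ Set.Ioo a.2 b.2 := by
  obtain ⟨s, t, hs, ht, hst, rfl⟩ := hp
  exact openSegment_subset_Ioo hab ⟨s, t, hs, ht, hst, rfl⟩

theorem not_edgesCross_of_snd_le {a b c d : V} (hab : (pos a).2 < (pos b).2)
    (hcd : (pos c).2 < (pos d).2) (hbc : (pos b).2 ≤ (pos c).2) :
    ¬ EdgesCross pos s(a, b) s(c, d) := by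
  rintro ⟨p, hp, hq⟩
  exact ((snd_mem_Ioo_of_mem_openSegment hab hp).2.trans_le hbc).asymm
    (snd_mem_Ioo_of_mem_openSegment hcd hq).1

theorem orient_of_snd_eq_left {a b c : ℝ × ℝ} (h : a.2 = c.2) :
    orient a b c = (b.2 - a.2) * (a.1 - c.1) := by
  unfold orient
  rw [h]
  ring

theorem orient_of_snd_eq_right {a b c : ℝ × ℝ} (h : b.2 = c.2) :
    orient a b c = (b.2 - a.2) * (b.1 - c.1) := by
  unfold orient
  rw [h]
  ring

theorem edgesCross_iff_of_snd_eq {a b c d : V} (hab : (pos a).2 ≠ (pos b).2)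
    (hac : (pos a).2 = (pos c).2) (hbd : (pos b).2 = (pos d).2) (hne : (pos a).1 ≠ (pos c).1) :
    EdgesCross pos s(a, b) s(c, d) ↔
      ((pos a).1 - (pos c).1) * ((pos b).1 - (pos d).1) < 0 := by
  have hh : 0 < ((pos b).2 - (pos a).2) ^ 2 := sq_pos_of_ne_zero (sub_ne_zero.mpr hab.symm)
  have hcd : orient (pos a) (pos b) (pos c) * orient (pos a) (pos b) (pos d) =
      ((pos b).2 - (pos a).2) ^ 2 * (((pos a).1 - (pos c).1) * ((pos b).1 - (pos d).1)) := by
    rw [orient_of_snd_eq_left hac, orient_of_snd_eq_right hbd]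
    ring
  have hba : orient (pos c) (pos d) (pos a) * orient (pos c) (pos d) (pos b) =
      ((pos b).2 - (pos a).2) ^ 2 * (((pos a).1 - (pos c).1) * ((pos b).1 - (pos d).1)) := by
    rw [orient_of_snd_eq_left hac.symm, orient_of_snd_eq_right hbd.symm, hac, hbd]
    ring
  have hab' := sub_ne_zero.mpr hab.symm
  have habc : orient (pos a) (pos b) (pos c) ≠ 0 := by
    rw [orient_of_snd_eq_left hac]
    exact mul_ne_zero hab' (sub_ne_zero.mpr hne)
  have hcda : orient (pos c) (pos d) (pos a) ≠ 0 := by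
    rw [orient_of_snd_eq_left hac.symm, ← hac, ← hbd]
    exact mul_ne_zero hab' (sub_ne_zero.mpr hne.symm)
  rw [edgesCross_iff_orient (Or.inl habc) (Or.inl hcda), hcd, hba, and_self, ← smul_eq_mul,
    smul_neg_iff_of_pos_left hh]

namespace IsLayering

variable {G : SimpleGraph V} {r : ℕ} {layer : V → Fin r} {y : Fin r → ℝ}

theorem snd_lt_iff (h : IsLayering G pos layer y) {u v : V} :
    (pos u).2 < (pos v).2 ↔ (layer u : ℕ) < layer v := by
  rw [h.height, h.height, h.strictMono.lt_iff_lt, Fin.lt_def]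

theorem snd_eq_iff (h : IsLayering G pos layer y) {u v : V} :
    (pos u).2 = (pos v).2 ↔ (layer u : ℕ) = layer v := by
  rw [h.height, h.height, h.strictMono.injective.eq_iff, Fin.ext_iff]

theorem comap (h : IsLayering G pos layer y) {W : Type*} {f : W → V}
    (hf : Function.Injective f) : IsLayering (G.comap f) (pos ∘ f) (layer ∘ f) y where
  injective := h.injective.comp hf
  strictMono := h.strictMono
  height v := h.height (f v)
  adj u v := h.adj (f u) (f v)

theorem exists_mk_eq_of_mem_edgeSet (h : IsLayering G pos layer y) {e : Sym2 V}
    (he : e ∈ G.edgeSet) : ∃ a b, e = s(a, b) ∧ (layer a : ℕ) + 1 = layer b := by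
  induction e with
  | h a b =>
    rcases h.adj a b he with hab | hba
    · exact ⟨a, b, rfl, hab⟩
    · exact ⟨b, a, Sym2.eq_swap, hba⟩

theorem layer_le_of_edgesCross (h : IsLayering G pos layer y) {a b c d : V}
    (hab : (layer a : ℕ) + 1 = layer b) (hcd : (layer c : ℕ) + 1 = layer d)
    (hcross : EdgesCross pos s(a, b) s(c, d)) : (layer c : ℕ) ≤ layer a := by
  by_contra! hac
  refine not_edgesCross_of_snd_le (h.snd_lt_iff.mpr ?_) (h.snd_lt_iff.mpr ?_)
    (not_lt.mp (h.snd_lt_iff.not.mpr ?_)) hcross <;> omega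

theorem layer_eq_of_edgesCross (h : IsLayering G pos layer y) {a b c d : V}
    (hab : (layer a : ℕ) + 1 = layer b) (hcd : (layer c : ℕ) + 1 = layer d)
    (hcross : EdgesCross pos s(a, b) s(c, d)) : (layer a : ℕ) = layer c :=
  le_antisymm (h.layer_le_of_edgesCross hcd hab hcross.symm)
    (h.layer_le_of_edgesCross hab hcd hcross)

theorem numCrossings_eq_sum [Finite V] (h : IsLayering G pos layer y) :
    numCrossings G pos = ∑ i ∈ Finset.range (r - 1),
      numCrossings (bilayerGraph G layer i) (bilayerPos pos layer i) := by
  refine numCrossings_eq_sum_induce G pos ?_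
  rintro _ ⟨e, f, rfl, he, hf, -, hcross⟩
  obtain ⟨a, b, rfl, hab⟩ := h.exists_mk_eq_of_mem_edgeSet he
  obtain ⟨c, d, rfl, hcd⟩ := h.exists_mk_eq_of_mem_edgeSet hf
  have hac := h.layer_eq_of_edgesCross hab hcd hcross
  simp only [Sym2.mem_iff, forall_eq_or_imp, forall_eq, bilayer, Set.mem_ofPred_eq,
    Finset.mem_range]
  refine ⟨layer a, ?_, fun i hi => by omega⟩
  have := (layer b).isLt
  omega

end IsLayering

/-- The vertices are numbered from the lowest height to the highest, and from left to right at
each height. -/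
def IsSweepOrdered [Preorder V] (pos : V → ℝ × ℝ) : Prop :=
  StrictMono fun v => toLex ((pos v).2, (pos v).1)

theorem exists_perm_isSweepOrdered {n : ℕ} {pos : Fin n → ℝ × ℝ}
    (h : Function.Injective pos) : ∃ σ : Equiv.Perm (Fin n), IsSweepOrdered (pos ∘ σ) := by
  let key : Fin n → ℝ ×ₗ ℝ := fun v => toLex ((pos v).2, (pos v).1)
  have hkey : Function.Injective key := fun u v huv => by
    obtain ⟨h₂, h₁⟩ := Prod.ext_iff.mp (toLex_inj.mp huv)
    exact h (Prod.ext h₁ h₂)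
  exact ⟨Tuple.sort key,
    (Tuple.monotone_sort key).strictMono_of_injective (hkey.comp (Tuple.sort key).injective)⟩

section SweepOrdered

variable [LinearOrder V] {G : SimpleGraph V} {r : ℕ} {layer : V → Fin r} {y : Fin r → ℝ}

theorem IsSweepOrdered.lt_iff (hs : IsSweepOrdered pos) {u v : V} :
    u < v ↔ (pos u).2 < (pos v).2 ∨ (pos u).2 = (pos v).2 ∧ (pos u).1 < (pos v).1 :=
  hs.lt_iff_lt.symm.trans Prod.Lex.toLex_lt_toLex

theorem IsLayering.layer_succ_of_lt (h : IsLayering G pos layer y) (hs : IsSweepOrdered pos)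
    {a b : V} (hadj : G.Adj a b) (hab : a < b) : (layer a : ℕ) + 1 = layer b := by
  rw [hs.lt_iff, h.snd_lt_iff, h.snd_eq_iff] at hab
  have := h.adj a b hadj
  omega

theorem IsLayering.edgesCross_iff_lt (h : IsLayering G pos layer y) (hs : IsSweepOrdered pos)
    {a b c d : V} (hadj : G.Adj a b) (hadj' : G.Adj c d) (hab : a < b) (hcd : c < d)
    (hac : a < c) : EdgesCross pos s(a, b) s(c, d) ↔ d < b := by
  have hab := h.layer_succ_of_lt hs hadj hab
  have hcd := h.layer_succ_of_lt hs hadj' hcd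
  rcases hs.lt_iff.mp hac with hac | ⟨hac, hx⟩
  · rw [h.snd_lt_iff] at hac
    refine iff_of_false (fun hcross => hac.ne (h.layer_eq_of_edgesCross hab hcd hcross)) ?_
    rw [hs.lt_iff, h.snd_lt_iff, h.snd_eq_iff]
    omega
  · have hlayer := h.snd_eq_iff.mp hac
    have hbd : (pos b).2 = (pos d).2 := h.snd_eq_iff.mpr (by omega)
    have hne : (pos a).2 ≠ (pos b).2 := h.snd_eq_iff.not.mpr (by omega)
    rw [edgesCross_iff_of_snd_eq hne hac hbd hx.ne, hs.lt_iff, hbd]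
    simp [mul_neg_iff, hx, hx.not_gt]

theorem IsLayering.not_edgesCross_of_common (h : IsLayering G pos layer y)
    (hs : IsSweepOrdered pos) {a b d : V} (hadj : G.Adj a b) (hadj' : G.Adj a d) (hab : a < b)
    (had : a < d) (hbd : b ≠ d) : ¬ EdgesCross pos s(a, b) s(a, d) := by
  have hab := h.layer_succ_of_lt hs hadj hab
  have had := h.layer_succ_of_lt hs hadj' had
  have hy : (pos b).2 = (pos d).2 := h.snd_eq_iff.mpr (by omega)
  have hne : (pos b).2 ≠ (pos a).2 := h.snd_eq_iff.not.mpr (by omega)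
  refine _root_.not_edgesCross_of_common ?_
  rw [orient_of_snd_eq_right hy]
  exact mul_ne_zero (sub_ne_zero.mpr hne)
    (sub_ne_zero.mpr fun hx => hbd (h.injective (Prod.ext hx hy)))

end SweepOrdered

end Layers

/-! ### Reasoning about programs -/

/-- Total correctness with a time bound: started in `s` with word bound `W`, the program `c` halts
after at most `B` steps in a state that satisfies `Q`. -/
def RunsWithin (W : ℕ) (c : RamProgram) (s : RamState) (B : ℕ) (Q : RamState → Prop) : Prop :=
  ∃ s' t, t ≤ B ∧ RamExec W c s t s' ∧ Q s'

/-- The program that runs `c` with register `x` ranging over the numbers below the content of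
register `0`, in increasing order; `c` must leave both registers unchanged. -/
def forLoop (x : ℕ) (c : RamProgram) : RamProgram :=
  .seq (.setReg x (.const 0))
    (.loop (.intLt (.reg x) (.reg 0)) (.seq c (.setReg x (.add (.reg x) (.const 1)))))

namespace RunsWithin

variable {W : ℕ} {c d : RamProgram} {s : RamState} {B B' : ℕ} {Q Q' : RamState → Prop}

theorem mono (h : RunsWithin W c s B Q) (hB : B ≤ B') (hQ : ∀ s', Q s' → Q' s') :
    RunsWithin W c s B' Q' := by
  obtain ⟨s', t, ht, hc, hs⟩ := h
  exact ⟨s', t, ht.trans hB, hc, hQ _ hs⟩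

theorem skip (h : Q s) : RunsWithin W .skip s 1 Q := ⟨s, 1, le_rfl, .skip s, h⟩

theorem setReg {x : ℕ} {e : IntExpr} (hW : e.eval s ≤ W)
    (h : Q { s with reg := Function.update s.reg x (e.eval s) }) :
    RunsWithin W (.setReg x e) s (e.cost + 1) Q :=
  ⟨_, _, le_rfl, .setReg s x e hW, h⟩

theorem storeInt {a : ℕ} {i e : IntExpr} (hW : e.eval s ≤ W)
    (h : Q { s with iarr :=
      Function.update s.iarr a (Function.update (s.iarr a) (i.eval s) (e.eval s)) }) :
    RunsWithin W (.storeInt a i e) s (i.cost + e.cost + 1) Q :=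
  ⟨_, _, le_rfl, .storeInt s a i e hW, h⟩

theorem seq (h : RunsWithin W c s B fun s' => RunsWithin W d s' B' Q) :
    RunsWithin W (.seq c d) s (B + B') Q := by
  obtain ⟨s', t, ht, hc, s'', t', ht', hd, hs⟩ := h
  exact ⟨s'', t + t', by omega, .seq hc hd, hs⟩

theorem branch {b : RamTest} (htrue : b.Holds s → RunsWithin W c s B Q)
    (hfalse : ¬ b.Holds s → RunsWithin W d s B Q) :
    RunsWithin W (.branch b c d) s (b.cost + B) Q := by
  by_cases hb : b.Holds s
  · obtain ⟨s', t, ht, hc, hs⟩ := htrue hb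
    exact ⟨s', _, by omega, .branchTrue hb hc, hs⟩
  · obtain ⟨s', t, ht, hd, hs⟩ := hfalse hb
    exact ⟨s', _, by omega, .branchFalse hb hd, hs⟩

theorem loop {b : RamTest} {I : ℕ → RamState → Prop} (N : ℕ) (hzero : I 0 s)
    (hstep : ∀ j < N, ∀ s, I j s → b.Holds s ∧ RunsWithin W c s B (I (j + 1)))
    (hexit : ∀ s, I N s → ¬ b.Holds s) :
    RunsWithin W (.loop b c) s ((b.cost + B) * N + b.cost) (I N) := by
  suffices h : ∀ m j, j + m = N → ∀ s, I j s →
      RunsWithin W (.loop b c) s ((b.cost + B) * m + b.cost) (I N) from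
    h N 0 (zero_add _) s hzero
  intro m
  induction m with
  | zero =>
    rintro j rfl s hs
    exact ⟨s, _, by simp, .loopDone (hexit s hs), hs⟩
  | succ m ih =>
    intro j hj s hs
    obtain ⟨hb, s', t, ht, hc, hs'⟩ := hstep j (by omega) s hs
    obtain ⟨s'', t', ht', hl, hs''⟩ := ih (j + 1) (by omega) s' hs'
    refine ⟨s'', _, ?_, .loopStep hb hc hl, hs''⟩
    rw [mul_add_one]
    omega

theorem forLoop {n x : ℕ} {I : ℕ → RamState → Prop} (hx : x ≠ 0) (hn : s.reg 0 = n) (hW : n ≤ W)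
    (hzero : I 0 { s with reg := Function.update s.reg x 0 })
    (hstep : ∀ (j : Fin n) (s : RamState), s.reg 0 = n → s.reg x = j → I j s →
      RunsWithin W c s B fun s' => s'.reg 0 = n ∧ s'.reg x = j ∧
        I (j + 1) { s' with reg := Function.update s'.reg x (j + 1) }) :
    RunsWithin W (forLoop x c) s ((B + 7) * n + 5) fun s' => s'.reg 0 = n ∧ I n s' := by
  have hloop := loop (W := W) (b := .intLt (.reg x) (.reg 0))
    (c := .seq c (.setReg x (.add (.reg x) (.const 1)))) (B := B + 4)
    (s := { s with reg := Function.update s.reg x 0 })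
    (I := fun j s => s.reg 0 = n ∧ s.reg x = j ∧ I j s) n
    ⟨by simp [Function.update_of_ne hx.symm, hn], by simp, hzero⟩ ?_ ?_
  · obtain ⟨s', t, ht, hl, h0, -, hI⟩ := hloop
    refine ⟨s', _, ?_, .seq (.setReg s x (.const 0) (Nat.zero_le _)) hl, h0, hI⟩
    simp only [RamTest.cost, IntExpr.cost] at ht ⊢
    linarith
  · rintro j hj s ⟨h0, hsx, hI⟩
    refine ⟨by simpa [RamTest.Holds, IntExpr.eval, h0, hsx] using hj,
      seq ((hstep ⟨j, hj⟩ s h0 hsx hI).mono le_rfl ?_)⟩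
    rintro s' ⟨h0', hsx', hI'⟩
    refine setReg ?_ ?_
    · simpa only [IntExpr.eval, hsx'] using (show j + 1 ≤ W by omega)
    · simp only [IntExpr.eval, hsx']
      exact ⟨by simp [Function.update_of_ne hx.symm, h0'], by simp, hI'⟩
  · rintro s ⟨h0, hsx, -⟩
    simp [RamTest.Holds, IntExpr.eval, h0, hsx]

end RunsWithin

/-! ### Prefix sums -/

section PrefixSum

variable {n : ℕ}

/-- The sum of the first `m` values of `f`, with `m` a natural number so that it can be the content
of a loop register; for `m ≥ n` it is the sum of all values. -/
def prefixSum (f : Fin n → ℕ) (m : ℕ) : ℕ := ∑ i ∈ {i : Fin n | (i : ℕ) < m}, f i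

theorem prefixSum_zero (f : Fin n → ℕ) : prefixSum f 0 = 0 := by simp [prefixSum]

theorem prefixSum_succ (f : Fin n → ℕ) (m : Fin n) :
    prefixSum f (m + 1) = prefixSum f m + f m := by
  have hfilter : Finset.univ.filter (fun i : Fin n => (i : ℕ) < m + 1) =
      insert m (Finset.univ.filter fun i : Fin n => (i : ℕ) < m) := by
    ext i
    simp only [Finset.mem_filter_univ, Finset.mem_insert, Fin.ext_iff]
    omega
  rw [prefixSum, hfilter, Finset.sum_insert (by simp), add_comm, prefixSum]

theorem prefixSum_self (f : Fin n → ℕ) : prefixSum f n = ∑ i, f i := by simp [prefixSum]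

theorem prefixSum_val (f : Fin n → ℕ) (k : Fin n) : prefixSum f k = ∑ i with i < k, f i := rfl

theorem prefixSum_le {f : Fin n → ℕ} {c : ℕ} (hf : ∀ i, f i ≤ c) (m : ℕ) :
    prefixSum f m ≤ n * c := calc
  prefixSum f m ≤ ∑ i, f i := Finset.sum_le_sum_of_subset (Finset.filter_subset _ _)
  _ ≤ n * c := by simpa using Finset.sum_le_card_nsmul Finset.univ f c (by simpa using hf)

end PrefixSum

/-! ### Sorting by counting predecessors -/

/-- Store in register `4` the number of values of register `3` that pass the test `b`. -/
def countLoop (b : RamTest) : RamProgram :=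
  .seq (.setReg 4 (.const 0))
    (forLoop 3 (.branch b (.setReg 4 (.add (.reg 4) (.const 1))) .skip))

/-- Sort the vertices into integer array `1`; the test `b` decides whether the vertex in register
`3` precedes the one in register `2`. -/
def rankProgram (b : RamTest) : RamProgram :=
  forLoop 2 (.seq (countLoop b) (.storeInt 1 (.reg 4) (.reg 2)))

section Rank

variable {n W : ℕ} {b : RamTest} {s : RamState}

theorem countLoop_runs (hn : s.reg 0 = n) (hW : n ≤ W) (p : Fin n → Prop) [DecidablePred p]
    (hb : ∀ (s' : RamState) (i : Fin n), s'.rarr = s.rarr → s'.reg 2 = s.reg 2 → s'.reg 3 = i →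
      (b.Holds s' ↔ p i)) :
    RunsWithin W (countLoop b) s ((b.cost + 11) * n + 7) fun s' =>
      (∀ x, x ≠ 3 → x ≠ 4 → s'.reg x = s.reg x) ∧ s'.reg 4 = Finset.card {i | p i} ∧
        s'.iarr = s.iarr ∧ s'.rarr = s.rarr := by
  have hcount (m : ℕ) : prefixSum (fun i => if p i then 1 else 0) m ≤ n := by
    simpa using prefixSum_le (c := 1) (fun i => by split_ifs <;> simp) m
  refine (RunsWithin.seq (RunsWithin.setReg (Nat.zero_le _) ((RunsWithin.forLoop (B := b.cost + 4)
    (I := fun m s' => (∀ x, x ≠ 3 → x ≠ 4 → s'.reg x = s.reg x) ∧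
      s'.reg 4 = prefixSum (fun i => if p i then 1 else 0) m ∧
        s'.iarr = s.iarr ∧ s'.rarr = s.rarr)
    (by norm_num) (by simpa using hn) hW ?_ ?_).mono le_rfl ?_))).mono
      (B := 2 + ((b.cost + 4 + 7) * n + 5)) (by ring_nf; rfl) fun _ h => h
  · refine ⟨fun x h3 h4 => ?_, ?_, rfl, rfl⟩
    · simp [h3, h4]
    · simp [prefixSum_zero, IntExpr.eval]
  · rintro i s' h0 h3 ⟨hreg, h4, hi, hr⟩
    have hp := hb s' i hr (hreg 2 (by norm_num) (by norm_num)) h3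
    have hsucc := prefixSum_succ (fun i => if p i then 1 else 0) i
    refine RunsWithin.branch (fun htrue => ?_) (fun hfalse => ?_)
    · rw [if_pos (hp.mp htrue)] at hsucc
      refine RunsWithin.setReg (e := .add (.reg 4) (.const 1)) ?_ ⟨by simpa using h0,
        by simpa using h3, fun x hx3 hx4 => ?_, ?_, hi, hr⟩
      · simpa only [IntExpr.eval, h4, ← hsucc] using (hcount _).trans hW
      · simpa [hx3, hx4] using hreg x hx3 hx4
      · simp [IntExpr.eval, h4, hsucc]
    · rw [if_neg (fun h => hfalse (hp.mpr h)), add_zero] at hsucc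
      refine (RunsWithin.skip ⟨h0, h3, fun x hx3 hx4 => ?_, ?_, hi, hr⟩).mono
        (B := 1) (by omega) fun _ h => h
      · simpa [hx3] using hreg x hx3 hx4
      · simpa [hsucc] using h4
  · rintro s' ⟨-, hreg, h4, hi, hr⟩
    exact ⟨hreg, by rw [h4, prefixSum_self, Finset.card_filter], hi, hr⟩

theorem card_filter_symm_lt (σ : Equiv.Perm (Fin n)) (v : Fin n) :
    Finset.card {u | σ.symm u < σ.symm v} = σ.symm v := by
  rw [← Fin.card_Iio (σ.symm v), ← (Finset.Iio (σ.symm v)).card_map σ.toEmbedding]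
  congr 1
  ext u
  simp

theorem rankProgram_runs (hn : s.reg 0 = n) (hW : n ≤ W) (σ : Equiv.Perm (Fin n))
    (hb : ∀ (s' : RamState) (u v : Fin n), s'.rarr = s.rarr → s'.reg 3 = u → s'.reg 2 = v →
      (b.Holds s' ↔ σ.symm u < σ.symm v)) :
    RunsWithin W (rankProgram b) s (((b.cost + 11) * n + 17) * n + 5) fun s' =>
      s'.reg 0 = n ∧ s'.reg 1 = s.reg 1 ∧ (∀ a ≠ 1, s'.iarr a = s.iarr a) ∧
        ∀ k : Fin n, s'.iarr 1 k = σ k := by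
  refine (RunsWithin.forLoop (B := (b.cost + 11) * n + 10)
    (I := fun m s' => s'.reg 1 = s.reg 1 ∧ s'.rarr = s.rarr ∧ (∀ a ≠ 1, s'.iarr a = s.iarr a) ∧
      ∀ k : Fin n, (σ k : ℕ) < m → s'.iarr 1 k = σ k) (by norm_num) hn hW (by simp) ?_).mono le_rfl
    fun s' h => ⟨h.1, h.2.1, h.2.2.2.1, fun k => h.2.2.2.2 k (σ k).2⟩
  rintro v s' h0 h2 ⟨h1, hr, ha, hrank⟩
  refine (RunsWithin.seq (RunsWithin.mono (countLoop_runs h0 hW (fun u => σ.symm u < σ.symm v)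
    fun s'' u hr' h2' h3' => hb s'' u v (hr'.trans hr) h3' (h2'.trans h2)) le_rfl ?_)).mono
      (B := ((b.cost + 11) * n + 7) + 3) (by omega) fun _ h => h
  rintro s'' ⟨hreg, h4, hi', hr'⟩
  rw [card_filter_symm_lt] at h4
  have h2' : s''.reg 2 = v := (hreg 2 (by norm_num) (by norm_num)).trans h2
  refine RunsWithin.storeInt ?_ ⟨(hreg 0 (by norm_num) (by norm_num)).trans h0, h2', ?_,
    hr'.trans hr, fun a h => ?_, fun k hk => ?_⟩
  · simpa only [IntExpr.eval, h2'] using v.2.le.trans hW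
  · simpa [hreg 1] using h1
  · simpa [h, hi'] using ha a h
  · simp only [IntExpr.eval, h2', h4, Function.update_self]
    obtain rfl | hkv := eq_or_ne (σ k) v
    · simp
    · rw [Function.update_of_ne, hi', hrank k]
      · have := Fin.val_ne_of_ne hkv
        omega
      · rw [Ne, Fin.val_inj, Equiv.eq_symm_apply]
        exact hkv

end Rank

/-! ### Counting pairs of edges in one sweep -/

section PairCounts

variable {n : ℕ}

/-- The number of edges from ranks below `k` to the rank `l`, for the adjacency matrix `A`. -/
def edgesBelow (A : Matrix (Fin n) (Fin n) ℕ) (k : ℕ) (l : Fin n) : ℕ :=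
  prefixSum (fun i => A i l) k

/-- The number of edges from ranks below `k` to ranks above `k`, where only the first `m` ranks in
the order `τ` are considered as upper ends. -/
def visitedEdges (A : Matrix (Fin n) (Fin n) ℕ) (τ : Fin n → Fin n) (k : Fin n) (m : ℕ) : ℕ :=
  prefixSum (fun j => if k < τ j then edgesBelow A k (τ j) else 0) m

/-- The number of pairs formed by an edge from `k` up to a rank `τ j` with `j < m` and an edge from
a rank below `k` to a rank above `k` that precedes `τ j` in the order `τ`. -/
def rowPairs (A : Matrix (Fin n) (Fin n) ℕ) (τ : Fin n → Fin n) (k : Fin n) (m : ℕ) : ℕ :=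
  prefixSum (fun j => if k < τ j then A k (τ j) * visitedEdges A τ k j else 0) m

variable {A : Matrix (Fin n) (Fin n) ℕ} {τ : Fin n → Fin n}

theorem edgesBelow_le (hA : ∀ i j, A i j ≤ 1) (k : ℕ) (l : Fin n) : edgesBelow A k l ≤ n := by
  simpa [edgesBelow] using prefixSum_le (fun i => hA i l) k

theorem visitedEdges_le (hA : ∀ i j, A i j ≤ 1) (k : Fin n) (m : ℕ) :
    visitedEdges A τ k m ≤ n * n := by
  refine prefixSum_le (fun j => ?_) m
  split_ifs
  exacts [edgesBelow_le hA k _, Nat.zero_le _]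

theorem rowPairs_le (hA : ∀ i j, A i j ≤ 1) (k : Fin n) (m : ℕ) :
    rowPairs A τ k m ≤ n * (n * n) := by
  refine prefixSum_le (fun j => ?_) m
  split_ifs
  · simpa using Nat.mul_le_mul (hA k (τ j)) (visitedEdges_le hA k j)
  · exact Nat.zero_le _

theorem visitedEdges_succ (k m : Fin n) : visitedEdges A τ k (m + 1) =
    visitedEdges A τ k m + if k < τ m then edgesBelow A k (τ m) else 0 :=
  prefixSum_succ _ m

theorem rowPairs_succ (k m : Fin n) : rowPairs A τ k (m + 1) =
    rowPairs A τ k m + if k < τ m then A k (τ m) * visitedEdges A τ k m else 0 :=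
  prefixSum_succ _ m

end PairCounts

/-- The adjacency matrix entry of the vertices whose ranks are in registers `2` and `5`. -/
def adjEntry : IntExpr :=
  .load 0 (.add (.mul (.load 1 (.reg 2)) (.reg 0)) (.load 1 (.reg 5)))

/-- Handle the pair of ranks in registers `2` and `5`: register `1` accumulates the number of
pairs, register `4` the number of edges visited in this row, integer array `2` the number of edges
to each rank. -/
def pairStep : RamProgram :=
  .seq (.setReg 1 (.add (.reg 1) (.mul adjEntry (.reg 4))))
    (.seq (.setReg 4 (.add (.reg 4) (.load 2 (.reg 5))))
      (.storeInt 2 (.reg 5) (.add (.load 2 (.reg 5)) adjEntry)))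

/-- Visit the ranks in the order described by the expression `e` of register `3`, and handle those
that exceed the rank in register `2`. -/
def rowProgram (e : IntExpr) : RamProgram :=
  .seq (.setReg 4 (.const 0)) (forLoop 3 (.seq (.setReg 5 e)
    (.branch (.intLt (.reg 2) (.reg 5)) pairStep .skip)))

/-- Sum the numbers of pairs over all rows. -/
def sweepProgram (e : IntExpr) : RamProgram := forLoop 2 (rowProgram e)

/-- The state of the sweep before row `k`; the entries of integer array `2` at ranks below `k` are
out of date and are not read again. -/
structure SweepInvariant {n : ℕ} (A : Matrix (Fin n) (Fin n) ℕ) (τ : Fin n → Fin n) (k : ℕ)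
    (s : RamState) : Prop where
  adj : ∀ i j : Fin n, s.iarr 0 (s.iarr 1 i * n + s.iarr 1 j) = A i j
  below : ∀ l : Fin n, k ≤ l → s.iarr 2 l = edgesBelow A k l
  total : s.reg 1 = prefixSum (fun k => rowPairs A τ k n) k

/-- The state of the sweep in row `k` after the first `m` visits. -/
structure RowInvariant {n : ℕ} (A : Matrix (Fin n) (Fin n) ℕ) (τ : Fin n → Fin n) (k : Fin n)
    (m : ℕ) (s : RamState) : Prop where
  row : s.reg 2 = k
  adj : ∀ i j : Fin n, s.iarr 0 (s.iarr 1 i * n + s.iarr 1 j) = A i j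
  below : ∀ j, k < τ j → s.iarr 2 (τ j) = edgesBelow A (if j < m then k + 1 else k) (τ j)
  visited : s.reg 4 = visitedEdges A τ k m
  total : s.reg 1 = prefixSum (fun k => rowPairs A τ k n) k + rowPairs A τ k m

section Sweep

variable {n W : ℕ} {A : Matrix (Fin n) (Fin n) ℕ} {s : RamState}

theorem SweepInvariant.rowInvariant {τ : Fin n → Fin n} {k : Fin n} (h : SweepInvariant A τ k s)
    (hk : s.reg 2 = k) :
    RowInvariant A τ k 0
      { s with reg := Function.update (Function.update s.reg 4 0) 3 0 } where
  row := by simpa using hk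
  adj := h.adj
  below j hj := by simpa using h.below (τ j) hj.le
  visited := by simp [visitedEdges, prefixSum_zero]
  total := by simpa [rowPairs, prefixSum_zero] using h.total

theorem RowInvariant.sweepInvariant {τ : Equiv.Perm (Fin n)} {k : Fin n}
    (h : RowInvariant A τ k n s) :
    SweepInvariant A τ (k + 1) { s with reg := Function.update s.reg 2 (k + 1) } where
  adj := h.adj
  below l hl := by simpa using h.below (τ.symm l) (by simpa using Fin.lt_def.mpr hl)
  total := by simpa [prefixSum_succ] using h.total

theorem RowInvariant.skip {τ : Fin n → Fin n} {k m : Fin n} (h : RowInvariant A τ k m s)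
    (hm : ¬ k < τ m) :
    RowInvariant A τ k (m + 1) { s with reg := Function.update s.reg 3 (m + 1) } where
  row := by simpa using h.row
  adj := h.adj
  below j hj := by
    have hjm : (j : ℕ) ≠ m := fun e => hm (Fin.ext e ▸ hj)
    have : (j : ℕ) < m + 1 ↔ (j : ℕ) < m := by omega
    simpa only [this] using h.below j hj
  visited := by simpa [visitedEdges_succ, hm] using h.visited
  total := by simpa [rowPairs_succ, hm] using h.total

theorem pairStep_runs {a : ℕ} (ha : adjEntry.eval s = a) (h1 : s.reg 1 + a * s.reg 4 ≤ W)
    (h4 : s.reg 4 + s.iarr 2 (s.reg 5) ≤ W) (h2 : s.iarr 2 (s.reg 5) + a ≤ W) :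
    RunsWithin W pairStep s 41 fun s' =>
      s'.reg 1 = s.reg 1 + a * s.reg 4 ∧ s'.reg 4 = s.reg 4 + s.iarr 2 (s.reg 5) ∧
        (∀ x, x ≠ 1 → x ≠ 4 → s'.reg x = s.reg x) ∧
        s'.iarr 2 = Function.update (s.iarr 2) (s.reg 5) (s.iarr 2 (s.reg 5) + a) ∧
        ∀ b ≠ 2, s'.iarr b = s.iarr b := by
  simp only [adjEntry, IntExpr.eval] at ha
  refine (RunsWithin.seq (RunsWithin.setReg ?_ (RunsWithin.seq (RunsWithin.setReg ?_
    (RunsWithin.storeInt ?_ ⟨?_, ?_, fun x hx1 hx4 => ?_, ?_, fun b hb => ?_⟩))))).mono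
      (by simp [IntExpr.cost, adjEntry]) fun _ h => h
  · simpa [IntExpr.eval, adjEntry, ha] using h1
  · simpa [IntExpr.eval] using h4
  · simpa [IntExpr.eval, adjEntry, ha] using h2
  · simp [IntExpr.eval, adjEntry, ha]
  · simp [IntExpr.eval]
  · simp [hx1, hx4]
  · simp [IntExpr.eval, adjEntry, ha]
  · simp [hb]

theorem mul_le_add_two_pow_four {i j : ℕ} (hi : i ≤ n ^ 3) (hj : j ≤ n + 1) :
    i * j ≤ (n + 2) ^ 4 := calc
  i * j ≤ (n + 2) ^ 3 * (n + 2) :=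
    Nat.mul_le_mul (hi.trans (Nat.pow_le_pow_left (by omega) 3)) (by omega)
  _ = (n + 2) ^ 4 := (pow_succ _ 3).symm

theorem le_add_two_pow_four {j : ℕ} (hj : j ≤ n + 2) : j ≤ (n + 2) ^ 4 :=
  hj.trans (Nat.le_self_pow (by norm_num) _)

theorem RowInvariant.pairStep_runs {τ : Equiv.Perm (Fin n)} {k m : Fin n}
    (hA : ∀ i j, A i j ≤ 1) (h : RowInvariant A τ k m s) (h0 : s.reg 0 = n) (h3 : s.reg 3 = m)
    (h5 : s.reg 5 = τ m) (hkm : k < τ m) :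
    RunsWithin ((n + 2) ^ 4) pairStep s 41 fun s' => s'.reg 0 = n ∧ s'.reg 3 = m ∧
      RowInvariant A τ k (m + 1) { s' with reg := Function.update s'.reg 3 (m + 1) } := by
  have hentry : adjEntry.eval s = A k (τ m) := by
    simp only [adjEntry, IntExpr.eval, h0, h.row, h5, h.adj]
  have hbelow : s.iarr 2 (τ m) = edgesBelow A k (τ m) := by simpa using h.below m hkm
  have hbelow_succ : edgesBelow A k (τ m) + A k (τ m) = edgesBelow A (k + 1) (τ m) :=
    (prefixSum_succ _ k).symm
  have htotal : s.reg 1 + A k (τ m) * s.reg 4 =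
      prefixSum (fun k => rowPairs A τ k n) k + rowPairs A τ k (m + 1) := by
    rw [h.total, h.visited, rowPairs_succ, if_pos hkm, add_assoc]
  have hvisited : s.reg 4 + s.iarr 2 (τ m) = visitedEdges A τ k (m + 1) := by
    rw [h.visited, hbelow, visitedEdges_succ, if_pos hkm]
  refine (_root_.pairStep_runs hentry ?_ ?_ ?_).mono le_rfl ?_
  · have := prefixSum_le (fun k => rowPairs_le (τ := τ) hA k n) k
    have := rowPairs_le (τ := τ) hA k (m + 1)
    have := mul_le_add_two_pow_four (n := n) (le_refl (n ^ 3)) le_rfl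
    rw [htotal]
    linarith
  · rw [h5, hvisited]
    exact (visitedEdges_le hA k _).trans (mul_le_add_two_pow_four (Nat.le_self_pow (by norm_num) n)
      n.le_succ)
  · rw [h5, hbelow, hbelow_succ]
    exact le_add_two_pow_four ((edgesBelow_le hA _ _).trans (Nat.le_add_right n 2))
  · rintro s' ⟨h1', h4', hreg, h2', harr⟩
    refine ⟨(hreg 0 (by norm_num) (by norm_num)).trans h0,
      (hreg 3 (by norm_num) (by norm_num)).trans h3, ?_, ?_, fun j hj => ?_, ?_, ?_⟩
    · simpa [hreg 2] using h.row
    · simpa [harr 0, harr 1] using h.adj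
    · obtain rfl | hjm := eq_or_ne j m
      · simp [h2', h5, hbelow, hbelow_succ]
      · have hlt : (j : ℕ) < m + 1 ↔ (j : ℕ) < m := by
          have := Fin.val_ne_of_ne hjm
          omega
        have hne : (τ j : ℕ) ≠ τ m := Fin.val_ne_of_ne (τ.injective.ne hjm)
        simpa [h2', h5, hne, hlt] using h.below j hj
    · simpa [h4', h5] using hvisited
    · simpa [h1'] using htotal

theorem rowProgram_runs {e : IntExpr} {τ : Equiv.Perm (Fin n)} {k : Fin n}
    (hA : ∀ i j, A i j ≤ 1)
    (he : ∀ (s : RamState) (m : Fin n), s.reg 0 = n → s.reg 3 = m → e.eval s = τ m)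
    (h0 : s.reg 0 = n) (hk : s.reg 2 = k) (h : SweepInvariant A τ k s) :
    RunsWithin ((n + 2) ^ 4) (rowProgram e) s ((e.cost + 53) * n + 7) fun s' =>
      s'.reg 0 = n ∧ RowInvariant A τ k n s' := by
  refine (RunsWithin.seq (RunsWithin.setReg (Nat.zero_le _) (RunsWithin.forLoop (n := n)
    (I := RowInvariant A τ k) (B := e.cost + 46) (by norm_num) (by simpa using h0)
    (le_add_two_pow_four (Nat.le_add_right n 2)) (h.rowInvariant hk) ?_))).mono
      (by simp only [IntExpr.cost]; linarith) fun _ h => h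
  rintro m s' h0' h3' h'
  refine (RunsWithin.seq (B' := 45) (RunsWithin.setReg ?_ ?_)).mono (by omega) fun _ h => h
  · rw [he s' m h0' h3']
    exact le_add_two_pow_four (by omega)
  · rw [he s' m h0' h3']
    have hrow : RowInvariant A τ k m { s' with reg := Function.update s'.reg 5 (τ m) } :=
      ⟨by simpa using h'.row, h'.adj, h'.below, by simpa using h'.visited, by simpa using h'.total⟩
    refine (RunsWithin.branch (B := 41) (fun hlt => ?_) (fun hle => ?_)).mono
      (by simp [RamTest.cost, IntExpr.cost]) fun _ h => h
    · refine hrow.pairStep_runs hA (by simpa using h0') (by simpa using h3') (by simp) ?_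
      simpa [RamTest.Holds, IntExpr.eval, h'.row] using hlt
    · refine (RunsWithin.skip ⟨by simpa using h0', by simpa using h3', hrow.skip ?_⟩).mono
        (by norm_num) fun _ h => h
      simpa [RamTest.Holds, IntExpr.eval, h'.row] using hle

theorem sweepProgram_runs {e : IntExpr} {τ : Equiv.Perm (Fin n)} (hA : ∀ i j, A i j ≤ 1)
    (he : ∀ (s : RamState) (m : Fin n), s.reg 0 = n → s.reg 3 = m → e.eval s = τ m)
    (h0 : s.reg 0 = n) (h1 : s.reg 1 = 0) (h2 : ∀ l, s.iarr 2 l = 0)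
    (hadj : ∀ i j : Fin n, s.iarr 0 (s.iarr 1 i * n + s.iarr 1 j) = A i j) :
    RunsWithin ((n + 2) ^ 4) (sweepProgram e) s (((e.cost + 53) * n + 14) * n + 5) fun s' =>
      s'.reg 1 = ∑ k, rowPairs A τ k n := by
  have hinit : SweepInvariant A τ 0 { s with reg := Function.update s.reg 2 0 } :=
    ⟨hadj, fun l _ => by simp [h2, edgesBelow, prefixSum_zero], by simp [h1, prefixSum_zero]⟩
  refine (RunsWithin.forLoop (B := (e.cost + 53) * n + 7) (by norm_num) h0
    (le_add_two_pow_four (Nat.le_add_right n 2)) hinit ?_).mono le_rfl ?_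
  · rintro k s' h0' hk h
    exact (rowProgram_runs hA he h0' hk h).mono le_rfl fun s'' h =>
      ⟨h.1, h.2.row, h.2.sweepInvariant⟩
  · rintro s' ⟨-, h⟩
    rw [h.total, prefixSum_self]

end Sweep

/-! ### Correctness of the counting program -/

section Counting

variable {n : ℕ}

theorem visitedEdges_eq_sum (A : Matrix (Fin n) (Fin n) ℕ) (τ : Equiv.Perm (Fin n)) (k d : Fin n) :
    visitedEdges A τ k (τ.symm d) =
      ∑ b, if τ.symm b < τ.symm d ∧ k < b then ∑ a, if a < k then A a b else 0 else 0 := by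
  simp only [visitedEdges, edgesBelow, prefixSum_val, Finset.sum_filter, ite_and]
  rw [← Equiv.sum_comp τ.symm]
  simp only [Equiv.apply_symm_apply]

theorem rowPairs_eq_sum (A : Matrix (Fin n) (Fin n) ℕ) (τ : Equiv.Perm (Fin n)) (k : Fin n) :
    rowPairs A τ k n = ∑ d, if k < d then A k d * visitedEdges A τ k (τ.symm d) else 0 := by
  rw [rowPairs, prefixSum_self, ← Equiv.sum_comp τ.symm]
  simp only [Equiv.apply_symm_apply]

theorem sum_rowPairs_eq_ncard {G : SimpleGraph (Fin n)} [DecidableRel G.Adj] {pos : Fin n → ℝ × ℝ}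
    {τ : Equiv.Perm (Fin n)}
    (hcross : ∀ a b c d, G.Adj a b → G.Adj c d → a < b → c < d → a < c →
      (EdgesCross pos s(a, b) s(c, d) ↔ c < b ∧ τ.symm b < τ.symm d)) :
    ∑ k, rowPairs (G.adjMatrix ℕ) τ k n = (crossingQuadruples G pos).ncard := by
  have hquad : crossingQuadruples G pos =
      Finset.univ.filter fun q : (Fin n × Fin n) × Fin n × Fin n =>
      (G.Adj q.2.1 q.2.2 ∧ q.2.1 < q.2.2) ∧ (τ.symm q.1.2 < τ.symm q.2.2 ∧ q.2.1 < q.1.2) ∧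
        q.1.1 < q.2.1 ∧ G.Adj q.1.1 q.1.2 := by
    ext ⟨⟨a, b⟩, c, d⟩
    simp only [crossingQuadruples, Set.mem_ofPred_eq, Finset.coe_filter_univ]
    constructor
    · rintro ⟨hab, hcd, hlt, hlt', hac, h⟩
      have := (hcross a b c d hab hcd hlt hlt' hac).mp h
      tauto
    · rintro ⟨⟨hcd, hlt'⟩, ⟨hbd, hcb⟩, hac, hab⟩
      have hlt := hac.trans hcb
      exact ⟨hab, hcd, hlt, hlt', hac, (hcross a b c d hab hcd hlt hlt' hac).mpr ⟨hcb, hbd⟩⟩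
  rw [hquad, Set.ncard_coe_finset, Finset.card_filter, Fintype.sum_prod_type_right,
    Fintype.sum_prod_type]
  refine Finset.sum_congr rfl fun c _ => ?_
  rw [rowPairs_eq_sum]
  refine Finset.sum_congr rfl fun d _ => ?_
  rw [Fintype.sum_prod_type_right, visitedEdges_eq_sum]
  simp only [ite_and, Finset.sum_ite_irrel, Finset.sum_const_zero, SimpleGraph.adjMatrix_apply,
    ite_mul, one_mul, zero_mul]
  split_ifs <;> rfl

theorem ramInput_adj (G : SimpleGraph (Fin n)) [DecidableRel G.Adj] (pos : Fin n → ℝ × ℝ)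
    (i j : Fin n) : (ramInput G pos).iarr 0 (i * n + j) = G.adjMatrix ℕ i j := by
  have hdecode : (∃ i' j' : Fin n, (i : ℕ) * n + j = i' * n + j' ∧ G.Adj i' j') ↔ G.Adj i j := by
    refine ⟨?_, fun h => ⟨i, j, rfl, h⟩⟩
    rintro ⟨i', j', h, hadj⟩
    have : finProdFinEquiv (i, j) = finProdFinEquiv (i', j') := Fin.ext (by
      simp only [finProdFinEquiv_apply_val]
      linarith)
    obtain ⟨rfl, rfl⟩ := Prod.ext_iff.mp (finProdFinEquiv.injective this)
    exact hadj
  simp [ramInput, hdecode, SimpleGraph.adjMatrix_apply]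

theorem ramInput_fst (G : SimpleGraph (Fin n)) (pos : Fin n → ℝ × ℝ) (u : Fin n) :
    (ramInput G pos).rarr 0 u = (pos u).1 := by
  simp [ramInput]

theorem ramInput_snd (G : SimpleGraph (Fin n)) (pos : Fin n → ℝ × ℝ) (u : Fin n) :
    (ramInput G pos).rarr 1 u = (pos u).2 := by
  simp [ramInput]

/-- Sort the vertices with the test `b`, then count crossings in one sweep over the sorted vertices
that visits the upper ends of the edges in the order described by `e`. -/
def countProgram (b : RamTest) (e : IntExpr) : RamProgram :=
  .seq (rankProgram b) (sweepProgram e)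

/-- The constant in the quadratic time bound of `countProgram b e`. -/
def countFactor (b : RamTest) (e : IntExpr) : ℕ := b.cost + e.cost + 95

theorem countProgram_runs (G : SimpleGraph (Fin n)) (pos : Fin n → ℝ × ℝ) {b : RamTest}
    {e : IntExpr} (σ τ : Equiv.Perm (Fin n)) [DecidableRel (G.comap σ).Adj]
    (hb : ∀ (s : RamState) (u v : Fin n), s.rarr = (ramInput G pos).rarr → s.reg 3 = u →
      s.reg 2 = v → (b.Holds s ↔ σ.symm u < σ.symm v))
    (he : ∀ (s : RamState) (m : Fin n), s.reg 0 = n → s.reg 3 = m → e.eval s = τ m) :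
    RunsWithin ((n + 2) ^ 4) (countProgram b e) (ramInput G pos)
      (countFactor b e * (n ^ 2 + 1)) fun s =>
        s.reg 1 = ∑ k, rowPairs ((G.comap σ).adjMatrix ℕ) τ k n := by
  classical
  refine (RunsWithin.seq (B' := ((e.cost + 53) * n + 14) * n + 5) ((rankProgram_runs
    (by simp [ramInput]) (le_add_two_pow_four (Nat.le_add_right n 2)) σ hb).mono
      le_rfl ?_)).mono ?_ fun _ h => h
  · rintro s ⟨h0, h1, harr, hrank⟩
    refine sweepProgram_runs (fun i j => ?_) he h0 (by simpa [ramInput] using h1)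
      (fun l => by simp [harr 2, ramInput]) fun i j => ?_
    · rw [SimpleGraph.adjMatrix_apply]
      split_ifs <;> simp
    · rw [hrank, hrank, harr 0 (by norm_num), ramInput_adj]
      simp [SimpleGraph.adjMatrix_apply]
  · have : n ≤ n ^ 2 := Nat.le_self_pow (by norm_num) n
    rw [countFactor]
    nlinarith

theorem countProgram_counts {G : SimpleGraph (Fin n)} {pos : Fin n → ℝ × ℝ} {b : RamTest}
    {e : IntExpr} (σ τ : Equiv.Perm (Fin n))
    (hb : ∀ (s : RamState) (u v : Fin n), s.rarr = (ramInput G pos).rarr → s.reg 3 = u →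
      s.reg 2 = v → (b.Holds s ↔ σ.symm u < σ.symm v))
    (he : ∀ (s : RamState) (m : Fin n), s.reg 0 = n → s.reg 3 = m → e.eval s = τ m)
    (hcross : ∀ a b c d, (G.comap σ).Adj a b → (G.comap σ).Adj c d → a < b → c < d → a < c →
      (EdgesCross (pos ∘ σ) s(a, b) s(c, d) ↔ c < b ∧ τ.symm b < τ.symm d))
    (hshare : ∀ a b d, (G.comap σ).Adj a b → (G.comap σ).Adj a d → a < b → a < d → b ≠ d →
      ¬ EdgesCross (pos ∘ σ) s(a, b) s(a, d)) :
    ∃ t ≤ countFactor b e * (n ^ 2 + 1), CountsCrossingsIn (countProgram b e) 4 G pos t := by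
  classical
  obtain ⟨s, t, ht, hexec, hs⟩ := countProgram_runs G pos σ τ hb he
  refine ⟨t, ht, s, hexec, ?_⟩
  rw [hs, ← numCrossings_comap_equiv G pos σ, numCrossings_eq_ncard_crossingQuadruples hshare,
    sum_rowPairs_eq_ncard hcross]

end Counting

/-! ### Convex and layered comparisons -/

section Programs

variable {n : ℕ} {G : SimpleGraph (Fin n)} {pos : Fin n → ℝ × ℝ} {s : RamState}

/-- The test whether the point of vertex `k` lies to the left of the line from the point of vertex
`i` to that of vertex `j`. -/
def leftTest (i j k : IntExpr) : RamTest :=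
  .realLt
    (.mul (.sub (.load 1 j) (.load 1 i)) (.sub (.load 0 k) (.load 0 i)))
    (.mul (.sub (.load 0 j) (.load 0 i)) (.sub (.load 1 k) (.load 1 i)))

/-- The comparison of the vertices in registers `3` and `2` in the counterclockwise order around
the convex hull that starts at vertex `0`. -/
def convexTest : RamTest :=
  .not (.and (.not (.and (.intLt (.reg 3) (.const 1)) (.intLt (.const 0) (.reg 2))))
    (.not (leftTest (.const 0) (.reg 3) (.reg 2))))

theorem leftTest_holds (hs : s.rarr = (ramInput G pos).rarr) {i j k : IntExpr} {u v w : Fin n}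
    (hi : i.eval s = u) (hj : j.eval s = v) (hk : k.eval s = w) :
    (leftTest i j k).Holds s ↔ 0 < orient (pos u) (pos v) (pos w) := by
  simp only [leftTest, RamTest.Holds, RealExpr.eval, hs, hi, hj, hk, ramInput_fst, ramInput_snd,
    orient, sub_pos]

theorem convexTest_holds (hs : s.rarr = (ramInput G pos).rarr) {o u v : Fin n} (ho : (o : ℕ) = 0)
    (hu : s.reg 3 = u) (hv : s.reg 2 = v) : convexTest.Holds s ↔ CcwBefore pos o u v := by
  have hfirst : (s.reg 3 < 1 ∧ 0 < s.reg 2) ↔ (u = o ∧ v ≠ o) := by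
    rw [hu, hv, Fin.ext_iff, Ne, Fin.ext_iff, ho]
    omega
  have hleft := leftTest_holds hs (i := .const 0) (j := .reg 3) (k := .reg 2) ho.symm hu hv
  simp only [convexTest, RamTest.Holds, hleft, IntExpr.eval, hfirst, CcwBefore]
  tauto

theorem convexProgram_counts (G : SimpleGraph (Fin n)) (h : ConvexIndependent ℝ pos) :
    ∃ t ≤ countFactor convexTest (.reg 3) * (n ^ 2 + 1),
      CountsCrossingsIn (countProgram convexTest (.reg 3)) 4 G pos t := by
  rcases Nat.eq_zero_or_pos n with rfl | hn
  · exact countProgram_counts (Equiv.refl _) (Equiv.refl _) (fun _ u => u.elim0)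
      (fun _ u => u.elim0) (fun a => a.elim0) (fun a => a.elim0)
  let o : Fin n := ⟨0, hn⟩
  have := isStrictTotalOrder_ccwBefore h o
  obtain ⟨σ, hσ⟩ := exists_equiv_fin_lt_iff (Fintype.card_fin n) (CcwBefore pos o)
  refine countProgram_counts σ (Equiv.refl _) (fun s u v hs hu hv => ?_) (fun s m _ hm => hm)
    (fun a b c d _ _ hab hcd hac => ?_) (fun a b d _ _ hab had hbd => ?_)
  · rw [convexTest_holds hs (o := o) rfl hu hv, ← hσ, Equiv.apply_symm_apply,
      Equiv.apply_symm_apply]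
  · exact edgesCross_iff_of_forall_orient_pos (fun u v w huv hvw =>
      orient_pos_of_ccwBefore h ((hσ u v).mpr huv) ((hσ v w).mpr hvw)) hab hcd hac
  · exact not_edgesCross_of_common (orient_ne_zero_of_convexIndependent h (σ.injective.ne hab.ne)
      (σ.injective.ne had.ne) (σ.injective.ne hbd))

/-- The comparison of the vertices in registers `3` and `2` by height, then from left to right. -/
def layeredTest : RamTest :=
  .not (.and (.not (.realLt (.load 1 (.reg 3)) (.load 1 (.reg 2))))
    (.not (.and (.not (.realLt (.load 1 (.reg 2)) (.load 1 (.reg 3))))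
      (.realLt (.load 0 (.reg 3)) (.load 0 (.reg 2))))))

theorem layeredTest_holds (hs : s.rarr = (ramInput G pos).rarr) {u v : Fin n} (hu : s.reg 3 = u)
    (hv : s.reg 2 = v) :
    layeredTest.Holds s ↔
      (pos u).2 < (pos v).2 ∨ (pos u).2 = (pos v).2 ∧ (pos u).1 < (pos v).1 := by
  simp only [layeredTest, RamTest.Holds, IntExpr.eval, RealExpr.eval, hs, hu, hv,
    ramInput_fst, ramInput_snd]
  grind

/-- The number `n - 1 - m`, where `m` is the content of register `3`. A sweep in this order visits
the upper ends from right to left, since edges between the same two layers cross if and only if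
their upper ends are in the reverse order of their lower ends. -/
def reverseRank : IntExpr := .sub (.sub (.reg 0) (.const 1)) (.reg 3)

theorem layeredProgram_counts (h : IsLayered G pos) :
    ∃ t ≤ countFactor layeredTest reverseRank * (n ^ 2 + 1),
      CountsCrossingsIn (countProgram layeredTest reverseRank) 4 G pos t := by
  obtain ⟨r, layer, y, h⟩ := h
  obtain ⟨σ, hσ⟩ := exists_perm_isSweepOrdered h.injective
  have h' := h.comap σ.injective
  refine countProgram_counts σ Fin.revPerm (fun s u v hs hu hv => ?_) (fun s m hn hm => ?_)
    (fun a b c d hadj hadj' hab hcd hac => ?_)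
    (fun a b d hadj hadj' => h'.not_edgesCross_of_common hσ hadj hadj')
  · rw [layeredTest_holds hs hu hv, hσ.lt_iff]
    simp only [Function.comp_apply, Equiv.apply_symm_apply]
  · simp only [reverseRank, IntExpr.eval, hn, hm, Fin.revPerm_apply, Fin.val_rev]
    omega
  · rw [h'.edgesCross_iff_lt hσ hadj hadj' hab hcd hac, Fin.revPerm_symm, Fin.revPerm_apply,
      Fin.revPerm_apply, Fin.rev_lt_rev, iff_and_self]
    exact hcd.trans

end Programs

open Asymptotics in
theorem eventually_quadratic_le (C : ℕ) {f : ℕ → ℕ}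
    (hf : (fun n : ℕ => (n : ℝ) ^ 2 / Real.log n) =o[Filter.atTop] fun n => (f n : ℝ))
    {ε : ℝ} (hε : 0 < ε) :
    ∀ᶠ n : ℕ in Filter.atTop, ((C * (n ^ 2 + 1) : ℕ) : ℝ) ≤ ε * (f n * Real.log n) := by
  have hc : 0 < ε / (2 * (C + 1)) := by positivity
  filter_upwards [hf.bound hc, Filter.eventually_ge_atTop 2] with n hn h2
  have hlog : 0 < Real.log n := Real.log_pos (by exact_mod_cast h2)
  rw [Real.norm_of_nonneg (by positivity), Real.norm_of_nonneg (by positivity),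
    div_le_iff₀ hlog] at hn
  have hone : (1 : ℝ) ≤ n ^ 2 := by exact_mod_cast Nat.one_le_pow 2 n (by omega)
  push_cast
  calc (C : ℝ) * ((n : ℝ) ^ 2 + 1) ≤ (C + 1) * (2 * n ^ 2) := by gcongr <;> linarith
    _ ≤ (C + 1) * (2 * (ε / (2 * (C + 1)) * f n * Real.log n)) := by gcongr
    _ = ε * (f n * Real.log n) := by field_simp

/-! ### Supporting functionals and rays -/

section SupportingFunctionals

variable {ι E : Type*} [AddCommGroup E] [Module ℝ E] {p : ι → E}

theorem convexIndependent_of_exists_forall_lt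
    (h : ∀ i, ∃ f : E →ₗ[ℝ] ℝ, ∀ j ≠ i, f (p i) < f (p j)) : ConvexIndependent ℝ p := by
  intro s i hi
  by_contra his
  obtain ⟨f, hf⟩ := h i
  have hs : p '' s ⊆ {q | f (p i) < f q} := by
    rintro _ ⟨j, hj, rfl⟩
    exact hf j fun hji => his (hji ▸ hj)
  exact lt_irrefl (f (p i)) (convexHull_min hs (convex_halfSpace_gt f.isLinear _) hi)

theorem exists_forall_lt_of_convexIndependent [TopologicalSpace E] [IsTopologicalAddGroup E]
    [ContinuousSMul ℝ E] [LocallyConvexSpace ℝ E] [T2Space E] [Finite ι]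
    (h : ConvexIndependent ℝ p) (i : ι) : ∃ f : E →L[ℝ] ℝ, ∀ j ≠ i, f (p i) < f (p j) := by
  have hi : p i ∉ convexHull ℝ (p '' {i}ᶜ) := fun hi => h _ _ hi rfl
  obtain ⟨f, c, hic, hc⟩ := geometric_hahn_banach_point_closed (convex_convexHull ℝ (p '' {i}ᶜ))
    ((Set.toFinite (p '' {i}ᶜ)).isCompact_convexHull ℝ).isClosed hi
  exact ⟨f, fun j hj => hic.trans (hc _ (subset_convexHull ℝ _ ⟨j, hj, rfl⟩))⟩

theorem convex_insert_halfSpace (f : E →ₗ[ℝ] ℝ) (x : E) :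
    Convex ℝ (insert x {q | f x < f q}) := by
  rw [convex_iff_openSegment_subset]
  rintro y hy z hz _ ⟨a, b, ha, hb, hab, rfl⟩
  obtain rfl : a = 1 - b := by linarith
  simp only [Set.mem_insert_iff, Set.mem_ofPred_eq, map_add, map_smul, smul_eq_mul] at hy hz ⊢
  rcases hy with rfl | hy
  · rcases hz with rfl | hz
    · exact Or.inl (Convex.combo_self hab _)
    · exact Or.inr (by nlinarith)
  · right
    have hz : f x ≤ f z := hz.elim (fun hz => by rw [hz]) le_of_lt
    nlinarith

theorem eq_of_mem_convexHull_of_map_eq {f : E →ₗ[ℝ] ℝ} {i : ι} (hf : ∀ j ≠ i, f (p i) < f (p j))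
    {q : E} (hq : q ∈ convexHull ℝ (Set.range p)) (hfq : f q = f (p i)) : q = p i := by
  have hsub : Set.range p ⊆ insert (p i) {q | f (p i) < f q} := by
    rintro _ ⟨j, rfl⟩
    exact (eq_or_ne j i).imp (congrArg p) (hf j)
  exact (convexHull_min hsub (convex_insert_halfSpace f (p i)) hq).resolve_right hfq.not_gt

end SupportingFunctionals

section Rays

variable {V : Type*} {pos : V → ℝ × ℝ}

theorem disjoint_openRay_convexHull {f : ℝ × ℝ →ₗ[ℝ] ℝ} {u : V}
    (hf : ∀ v ≠ u, f (pos u) < f (pos v)) {d : ℝ × ℝ} (hd : d ≠ 0) (hfd : f d = 0) :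
    Disjoint (openRay (pos u) d) (convexHull ℝ (Set.range pos)) := by
  rw [Set.disjoint_left]
  rintro _ ⟨t, ht, rfl⟩ hq
  have : pos u + t • d = pos u := eq_of_mem_convexHull_of_map_eq hf hq (by simp [hfd])
  exact smul_ne_zero ht.ne' hd (by simpa using this)

theorem exists_openRay_disjoint_convexHull [Finite V] (h : ConvexIndependent ℝ pos) (u : V) :
    ∃ d : ℝ × ℝ, d ≠ 0 ∧ Disjoint (openRay (pos u) d) (convexHull ℝ (Set.range pos)) ∧
      Disjoint (openRay (pos u) (-d)) (convexHull ℝ (Set.range pos)) := by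
  obtain ⟨f, hf⟩ := exists_forall_lt_of_convexIndependent h u
  obtain ⟨d, hfd, hd⟩ := (Submodule.ne_bot_iff _).mp
    ((f : ℝ × ℝ →ₗ[ℝ] ℝ).ker_ne_bot_of_finrank_lt (by simp))
  exact ⟨d, hd, disjoint_openRay_convexHull hf hd hfd,
    disjoint_openRay_convexHull hf (neg_ne_zero.mpr hd) (by rw [map_neg, hfd, neg_zero])⟩

theorem edgeSegment_subset_convexHull (pos : V → ℝ × ℝ) (e : Sym2 V) :
    edgeSegment pos e ⊆ convexHull ℝ (Set.range pos) := by
  induction e with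
  | h a b => exact segment_subset_convexHull (Set.mem_range_self a) (Set.mem_range_self b)

theorem rayCount_eq_zero (G : SimpleGraph V) {p d : ℝ × ℝ}
    (h : Disjoint (openRay p d) (convexHull ℝ (Set.range pos))) : rayCount G pos p d = 0 := by
  have : {e | e ∈ G.edgeSet ∧ (openRay p d ∩ edgeSegment pos e).Nonempty} = ∅ :=
    Set.eq_empty_iff_forall_notMem.mpr fun e ⟨_, he⟩ =>
      Set.not_disjoint_iff_nonempty_inter.mpr he
        (h.mono_right (edgeSegment_subset_convexHull pos e))
  rw [rayCount, this, Set.ncard_empty]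

end Rays

/-! ### Perturbation into convex position -/

section Stability

open Topology

variable {V : Type*} {G : SimpleGraph V} {pos pos' : V → ℝ × ℝ}

theorem eventually_sign_orient_eq [Finite V]
    (hG : ∀ a b c, G.Adj a b → c ≠ a → c ≠ b → orient (pos a) (pos b) (pos c) ≠ 0) :
    ∀ᶠ q in 𝓝 pos, ∀ a b c, G.Adj a b →
      SignType.sign (orient (q a) (q b) (q c)) =
        SignType.sign (orient (pos a) (pos b) (pos c)) := by
  simp only [Filter.eventually_all]
  intro a b c hab
  rcases eq_or_ne c a with rfl | hca
  · simp [orient_self_outer]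
  rcases eq_or_ne c b with rfl | hcb
  · simp [orient_self_right]
  have hcont : Continuous fun q : V → ℝ × ℝ => orient (q a) (q b) (q c) := by
    unfold orient
    fun_prop
  have hsign := (continuousAt_sign_of_ne_zero (hG a b c hab hca hcb)).comp
    (f := fun q : V → ℝ × ℝ => orient (q a) (q b) (q c)) hcont.continuousAt
  simpa only [ContinuousAt, nhds_discrete, Filter.tendsto_pure, Function.comp_apply] using hsign

theorem orient_ne_zero_or_of_mk_ne
    (hG : ∀ a b c, G.Adj a b → c ≠ a → c ≠ b → orient (pos a) (pos b) (pos c) ≠ 0)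
    {a b c d : V} (hab : G.Adj a b) (hcd : G.Adj c d) (hne : s(a, b) ≠ s(c, d)) :
    orient (pos a) (pos b) (pos c) ≠ 0 ∨ orient (pos a) (pos b) (pos d) ≠ 0 := by
  by_contra! h
  have hc : c = a ∨ c = b := by
    by_contra! hc
    exact hG a b c hab hc.1 hc.2 h.1
  have hd : d = a ∨ d = b := by
    by_contra! hd
    exact hG a b d hab hd.1 hd.2 h.2
  have := hcd.ne
  rw [Ne, Sym2.eq_iff] at hne
  grind

theorem edgesCross_iff_of_sign_orient_eq
    (hG : ∀ a b c, G.Adj a b → c ≠ a → c ≠ b → orient (pos a) (pos b) (pos c) ≠ 0)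
    (hsign : ∀ a b c, G.Adj a b → SignType.sign (orient (pos' a) (pos' b) (pos' c)) =
      SignType.sign (orient (pos a) (pos b) (pos c)))
    {e f : Sym2 V} (he : e ∈ G.edgeSet) (hf : f ∈ G.edgeSet) :
    EdgesCross pos' e f ↔ EdgesCross pos e f := by
  rcases eq_or_ne e f with rfl | hne
  · exact iff_of_true (edgesCross_self _ _) (edgesCross_self _ _)
  induction e with
  | h a b =>
    induction f with
    | h c d =>
      have hG' : ∀ a b c, G.Adj a b → c ≠ a → c ≠ b → orient (pos' a) (pos' b) (pos' c) ≠ 0 := by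
        intro a b c hab hca hcb
        rw [← sign_ne_zero, hsign a b c hab, sign_ne_zero]
        exact hG a b c hab hca hcb
      rw [edgesCross_iff_orient (orient_ne_zero_or_of_mk_ne hG' he hf hne)
          (orient_ne_zero_or_of_mk_ne hG' hf he hne.symm),
        edgesCross_iff_orient (orient_ne_zero_or_of_mk_ne hG he hf hne)
          (orient_ne_zero_or_of_mk_ne hG hf he hne.symm)]
      simp only [← sign_eq_neg_one_iff, sign_mul, hsign _ _ _ he, hsign _ _ _ hf]

theorem eventually_edgesCross_iff [Finite V]
    (hG : ∀ a b c, G.Adj a b → c ≠ a → c ≠ b → orient (pos a) (pos b) (pos c) ≠ 0) :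
    ∀ᶠ q in 𝓝 pos, ∀ e ∈ G.edgeSet, ∀ f ∈ G.edgeSet, (EdgesCross q e f ↔ EdgesCross pos e f) := by
  filter_upwards [eventually_sign_orient_eq hG] with q hq e he f hf
  exact edgesCross_iff_of_sign_orient_eq hG hq he hf

end Stability

section Bending

open Topology

variable {y₀ y₁ δ : ℝ} {p q : ℝ × ℝ}

/-- Bends the horizontal lines at the heights `y₀` and `y₁` towards each other into parabolas of
curvature proportional to `δ`. -/
def bend (y₀ y₁ δ : ℝ) (p : ℝ × ℝ) : ℝ × ℝ := (p.1, p.2 + δ * (y₀ + y₁ - 2 * p.2) * p.1 ^ 2)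

/-- A linear functional whose level line through `bend y₀ y₁ δ p` is tangent to the parabola
through that point. -/
noncomputable def bendNormal (y₀ y₁ δ : ℝ) (p : ℝ × ℝ) : ℝ × ℝ →ₗ[ℝ] ℝ :=
  (y₀ + y₁ - 2 * p.2) • LinearMap.snd ℝ ℝ ℝ -
    (2 * δ * (y₀ + y₁ - 2 * p.2) ^ 2 * p.1) • LinearMap.fst ℝ ℝ ℝ

theorem bendNormal_bend_lt_of_snd_eq (hδ : 0 < δ) (hp : y₀ + y₁ - 2 * p.2 ≠ 0) (h : p.2 = q.2)
    (hne : p ≠ q) : bendNormal y₀ y₁ δ p (bend y₀ y₁ δ p) <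
      bendNormal y₀ y₁ δ p (bend y₀ y₁ δ q) := by
  have hx : q.1 - p.1 ≠ 0 := sub_ne_zero.mpr fun hx => hne (Prod.ext hx.symm h)
  have : 0 < δ * ((y₀ + y₁ - 2 * p.2) * (q.1 - p.1)) ^ 2 := by positivity
  simp only [bendNormal, bend, LinearMap.sub_apply, LinearMap.smul_apply, LinearMap.fst_apply,
    LinearMap.snd_apply, smul_eq_mul, ← h]
  linarith

theorem eventually_bendNormal_bend_lt (h : 0 < (y₀ + y₁ - 2 * p.2) * (q.2 - p.2)) :
    ∀ᶠ δ in 𝓝 0, bendNormal y₀ y₁ δ p (bend y₀ y₁ δ p) <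
      bendNormal y₀ y₁ δ p (bend y₀ y₁ δ q) := by
  simp only [bendNormal, bend, LinearMap.sub_apply, LinearMap.smul_apply, LinearMap.fst_apply,
    LinearMap.snd_apply, smul_eq_mul]
  refine ContinuousAt.eventually_lt (by fun_prop) (by fun_prop) ?_
  linarith

theorem eventually_convexIndependent_bend {V : Type*} [Finite V] {pos : V → ℝ × ℝ}
    (hpos : Function.Injective pos) (hy : y₀ ≠ y₁)
    (hline : ∀ v, (pos v).2 = y₀ ∨ (pos v).2 = y₁) :
    ∀ᶠ δ in 𝓝[>] 0, ConvexIndependent ℝ (bend y₀ y₁ δ ∘ pos) := by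
  have hsq : 0 < (y₁ - y₀) ^ 2 := sq_pos_of_ne_zero (sub_ne_zero.mpr hy.symm)
  have hside : ∀ v w, (pos v).2 ≠ (pos w).2 →
      0 < (y₀ + y₁ - 2 * (pos v).2) * ((pos w).2 - (pos v).2) := by
    intro v w hvw
    rcases hline v with hv | hv <;> rcases hline w with hw | hw <;> rw [hv, hw] at hvw ⊢
    exacts [absurd rfl hvw, by linarith, by linarith, absurd rfl hvw]
  have hopposite : ∀ᶠ δ in 𝓝[>] 0, ∀ v w, (pos v).2 ≠ (pos w).2 →
      bendNormal y₀ y₁ δ (pos v) (bend y₀ y₁ δ (pos v)) <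
        bendNormal y₀ y₁ δ (pos v) (bend y₀ y₁ δ (pos w)) := by
    simp only [Filter.eventually_all]
    exact fun v w hvw => (eventually_bendNormal_bend_lt (hside v w hvw)).filter_mono
      nhdsWithin_le_nhds
  filter_upwards [hopposite, self_mem_nhdsWithin] with δ hδ hδpos
  refine convexIndependent_of_exists_forall_lt fun v =>
    ⟨bendNormal y₀ y₁ δ (pos v), fun w hwv => ?_⟩
  by_cases hvw : (pos v).2 = (pos w).2
  · refine bendNormal_bend_lt_of_snd_eq hδpos (fun h0 => hy ?_) hvw (hpos.ne hwv.symm)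
    rcases hline v with hv | hv <;> linarith
  · exact hδ v w hvw

theorem frequently_convexIndependent_of_snd_eq_or {V : Type*} [Finite V] {pos : V → ℝ × ℝ}
    (hpos : Function.Injective pos) (hy : y₀ ≠ y₁)
    (hline : ∀ v, (pos v).2 = y₀ ∨ (pos v).2 = y₁) : ∃ᶠ q in 𝓝 pos, ConvexIndependent ℝ q := by
  have hcont : Continuous fun δ => bend y₀ y₁ δ ∘ pos :=
    continuous_pi fun v => by simp only [Function.comp_apply, bend]; fun_prop
  have hlim : Filter.Tendsto (fun δ => bend y₀ y₁ δ ∘ pos) (𝓝[>] 0) (𝓝 pos) := by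
    refine (hcont.tendsto' 0 pos ?_).mono_left nhdsWithin_le_nhds
    ext v <;> simp [bend]
  exact hlim.frequently (eventually_convexIndependent_bend hpos hy hline).frequently

end Bending

section TwoLines

variable {V : Type*} {G : SimpleGraph V} {pos : V → ℝ × ℝ}

theorem orient_ne_zero_of_snd_eq_or (hpos : Function.Injective pos) {a b c : V}
    (hab : (pos a).2 ≠ (pos b).2) (hc : (pos c).2 = (pos a).2 ∨ (pos c).2 = (pos b).2)
    (hca : c ≠ a) (hcb : c ≠ b) : orient (pos a) (pos b) (pos c) ≠ 0 := by
  have hba := sub_ne_zero.mpr hab.symm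
  rcases hc with hc | hc
  · rw [orient_of_snd_eq_left hc.symm]
    exact mul_ne_zero hba (sub_ne_zero.mpr fun hx => hca (hpos (Prod.ext hx.symm hc)))
  · rw [orient_of_snd_eq_right hc.symm]
    exact mul_ne_zero hba (sub_ne_zero.mpr fun hx => hcb (hpos (Prod.ext hx.symm hc)))

theorem exists_convexIndependent_perturbation [Finite V] (hpos : Function.Injective pos)
    {y₀ y₁ : ℝ} (hy : y₀ ≠ y₁) (hline : ∀ v, (pos v).2 = y₀ ∨ (pos v).2 = y₁)
    (hadj : ∀ u v, G.Adj u v → (pos u).2 ≠ (pos v).2) {ε : ℝ} (hε : 0 < ε) :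
    ∃ pos' : V → ℝ × ℝ, ConvexIndependent ℝ pos' ∧ (∀ v, dist (pos' v) (pos v) < ε) ∧
      ∀ e ∈ G.edgeSet, ∀ f ∈ G.edgeSet, (EdgesCross pos' e f ↔ EdgesCross pos e f) := by
  have := Fintype.ofFinite V
  have hgeneric : ∀ a b c, G.Adj a b → c ≠ a → c ≠ b → orient (pos a) (pos b) (pos c) ≠ 0 := by
    intro a b c hab
    have hne := hadj a b hab
    refine orient_ne_zero_of_snd_eq_or hpos hne ?_
    rcases hline a with ha | ha <;> rcases hline b with hb | hb <;> rcases hline c with hc | hc <;>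
      simp_all
  have hnear : ∀ᶠ q in nhds pos, dist q pos < ε := Metric.ball_mem_nhds pos hε
  obtain ⟨pos', hconv, hdist, hcross⟩ :=
    ((frequently_convexIndependent_of_snd_eq_or hpos hy hline).and_eventually
      (hnear.and (eventually_edgesCross_iff hgeneric))).exists
  exact ⟨pos', hconv, (dist_pi_lt_iff hε).mp hdist, hcross⟩

theorem IsLayering.exists_convexIndependent_perturbation [Finite V] {r : ℕ} {layer : V → Fin r}
    {y : Fin r → ℝ} (h : IsLayering G pos layer y) {i : ℕ} (hi : i + 1 < r) {ε : ℝ} (hε : 0 < ε) :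
    ∃ pos' : bilayer layer i → ℝ × ℝ, ConvexIndependent ℝ pos' ∧
      (∀ v, dist (pos' v) (bilayerPos pos layer i v) < ε) ∧
      ∀ e ∈ (bilayerGraph G layer i).edgeSet, ∀ f ∈ (bilayerGraph G layer i).edgeSet,
        (EdgesCross pos' e f ↔ EdgesCross (bilayerPos pos layer i) e f) := by
  have hy : y ⟨i, by omega⟩ ≠ y ⟨i + 1, hi⟩ := h.strictMono.injective.ne (by simp)
  refine _root_.exists_convexIndependent_perturbation (h.injective.comp Subtype.val_injective) hy
    (fun v => ?_) (fun u v huv => ?_) hε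
  · exact v.2.imp (fun hv => (h.height v).trans (congrArg y (Fin.ext hv)))
      fun hv => (h.height v).trans (congrArg y (Fin.ext hv))
  · have := h.adj u v huv
    exact h.snd_eq_iff.not.mpr (by omega)

end TwoLines

theorem mainTheorem3 :
    -- convex geometric graphs: the number of crossings is computed in `O(n ^ 2)` time
    (∃ (P : RamProgram) (C k : ℕ), ∀ (n : ℕ) (G : SimpleGraph (Fin n)) (pos : Fin n → ℝ × ℝ),
      ConvexIndependent ℝ pos →
        ∃ t : ℕ, t ≤ C * (n ^ 2 + 1) ∧ CountsCrossingsIn P k G pos t) ∧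
    -- two opposite open rays at each vertex avoid the convex hull; they meet no edges
    (∀ (n : ℕ) (G : SimpleGraph (Fin n)) (pos : Fin n → ℝ × ℝ), ConvexIndependent ℝ pos →
      ∀ u : Fin n, ∃ d : ℝ × ℝ, d ≠ 0 ∧
        Disjoint (openRay (pos u) d) (convexHull ℝ (Set.range pos)) ∧
        Disjoint (openRay (pos u) (-d)) (convexHull ℝ (Set.range pos)) ∧
        rayCount G pos (pos u) d = 0 ∧ rayCount G pos (pos u) (-d) = 0) ∧
    -- layered graphs: `O(n ^ 2)` time, hence `o(|E| log |V|)` if there are `ω(n ^ 2 / log n)` edges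
    (∃ (P : RamProgram) (C k : ℕ),
      (∀ (n : ℕ) (G : SimpleGraph (Fin n)) (pos : Fin n → ℝ × ℝ), IsLayered G pos →
        ∃ t : ℕ, t ≤ C * (n ^ 2 + 1) ∧ CountsCrossingsIn P k G pos t) ∧
      (∀ f : ℕ → ℕ,
        Asymptotics.IsLittleO Filter.atTop
          (fun n : ℕ => (n : ℝ) ^ 2 / Real.log n) (fun n : ℕ => (f n : ℝ)) →
        ∀ ε : ℝ, 0 < ε → ∀ᶠ n : ℕ in Filter.atTop,
          ∀ (G : SimpleGraph (Fin n)) (pos : Fin n → ℝ × ℝ), IsLayered G pos →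
            f n ≤ G.edgeSet.ncard →
              ∃ t : ℕ, (t : ℝ) ≤ ε * ((G.edgeSet.ncard : ℝ) * Real.log n) ∧
                CountsCrossingsIn P k G pos t)) ∧
    -- layered graphs: the crossings are those of the bilayer subgraphs, each of which becomes
    -- a convex geometric graph with the same crossing pairs under arbitrarily small perturbations
    (∀ (n : ℕ) (G : SimpleGraph (Fin n)) (pos : Fin n → ℝ × ℝ) (r : ℕ) (layer : Fin n → Fin r)
      (y : Fin r → ℝ), IsLayering G pos layer y →
        numCrossings G pos =
          ∑ i ∈ Finset.range (r - 1),
            numCrossings (bilayerGraph G layer i) (bilayerPos pos layer i) ∧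
        ∀ i ∈ Finset.range (r - 1), ∀ ε : ℝ, 0 < ε →
          ∃ pos' : bilayer layer i → ℝ × ℝ, ConvexIndependent ℝ pos' ∧
            (∀ v, dist (pos' v) (bilayerPos pos layer i v) < ε) ∧
            ∀ e ∈ (bilayerGraph G layer i).edgeSet, ∀ f ∈ (bilayerGraph G layer i).edgeSet,
              (EdgesCross pos' e f ↔ EdgesCross (bilayerPos pos layer i) e f)) := by
  refine ⟨⟨_, _, 4, fun n G pos h => convexProgram_counts G h⟩, ?_,
    ⟨_, _, 4, fun n G pos h => layeredProgram_counts h, ?_⟩, ?_⟩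
  · intro n G pos h u
    obtain ⟨d, hd, hray, hray'⟩ := exists_openRay_disjoint_convexHull h u
    exact ⟨d, hd, hray, hray', rayCount_eq_zero G hray, rayCount_eq_zero G hray'⟩
  · intro f hf ε hε
    filter_upwards [eventually_quadratic_le (countFactor layeredTest reverseRank) hf hε]
      with n hn G pos h hE
    obtain ⟨t, ht, hcount⟩ := layeredProgram_counts h
    refine ⟨t, ((Nat.cast_le.mpr ht).trans hn).trans ?_, hcount⟩
    have := Real.log_natCast_nonneg n
    gcongr
  · intro n G pos r layer y h
    refine ⟨h.numCrossings_eq_sum, fun i hi ε hε =>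
      h.exists_convexIndependent_perturbation ?_ hε⟩
    have := Finset.mem_range.mp hi
    omega
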